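/- Let $A=\mathbb F_q[T]$, let $\varpi\in A$ be monic irreducible of degree $d$, $\wp=(\varpi)$, let $A_\wp$ be the $\wp$-adic completion of $A$ and $\mathbb C_\wp$ the completion of an algebraic closure of $\operatorname{Frac}(A_\wp)$, with absolute value normalized by $|\varpi|=q^{-d}$. Let $\mathbb F\subset A_\wp$ be the subfield isomorphic to $A/\wp$, and let $\iota:\mathbb F\to A_\wp/\wp A_\wp$ be the isomorphism induced by the quotient map. Let $\mathcal O\subset\mathbb C_\wp$ be a local subring that contains $A_\wp$, is complete for $|\cdot|$, has maximal ideal $\{x\in\mathcal O: |x|<1\}$, and contains every element of absolute value $<1$ of its fraction field (for example, $\mathcal O$ may be the valuation ring of any complete field between $\operatorname{Frac}(A_\wp)$ and $\mathbb C_\wp$). Let $\varphi$ be a Drinfeld module of rank $r\ge 2$ over $\mathcal O$ with underlying group scheme $\mathbb G_{a,\mathcal O}=\operatorname{Spec}\mathcal O[X]$, i.e. a ring homomorphism $a\mapsto\varphi_a$ from $A$ to the ring of additive polynomials in $\mathcal O[X]$ (under addition and composition) such that $\varphi_a$ has linear coefficient $a$ and, for $a\ne0$, degree $q^{r\deg a}$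 and leading coefficient in $\mathcal O^\times$. Write $\varphi_\varpi(X)=\sum_{i=0}^{rd}H_iX^{q^i}$ and $\varphi[\varpi]=\operatorname{Spec}\mathcal O[X]/(\varphi_\varpi)$. Let $\delta_0=\min\{|x| : 0\ne x\in\varphi[\varpi](\mathbb C_\wp)\}$. If $\{x\in\varphi[\varpi](\mathbb C_\wp): |x|\le\delta_0\}$ is an $A$-submodule that is free of rank $1$ over $A/\wp$ (via $\varphi$), it is called the canonical submodule of $\varphi$; a closed $A$-submodule scheme $C\subset\varphi[\varpi]$, (finite) flat over $\mathcal O$, is called the canonical submodule scheme of $\varphi$ if $C(\mathbb C_\wp)$ is the canonical submodule. **Theorem.** Suppose that $\varphi$ admits the canonical submodule scheme $C$. Then $H_d\neq0$, $\varpi/H_d\in\mathcal O$, and $C$ is isomorphic, as an $A$-module scheme over $\mathcal O$, to $$Z(\varpi/H_d)=\operatorname{Spec}\mathcal O[X]/\bigl(X^{q^d}+(\varpi/H_d)X\bigr),$$ a closed subgroup scheme of $\mathbb G_{a,\mathcal O}$ on which $A$ acts through $A\to A_\wp\to A_\wp/\wp A_\wp\xrightarrow{\iota^{-1}}\mathbb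 F$, with $\lambda\in\mathbb F$ acting by $X\mapsto\lambda X$. -/

import Mathlib

open Polynomial IsDedekindDomain
open scoped WithZero

universe u

noncomputable section

theorem add_pow_card_pow {Fq : Type u} [Field Fq] [Finite Fq] {R : Type*} [CommRing R]
    (f : Fq →+* R) (n : ℕ) (x y : R) :
    (x + y) ^ (Nat.card Fq ^ n) = x ^ (Nat.card Fq ^ n) + y ^ (Nat.card Fq ^ n) := by
  let := f.toAlgebra
  let := Fintype.ofFinite Fq
  induction n with
  | zero => simp
  | succ n ih =>
    have h : ∀ z : R, z ^ Nat.card Fq = FiniteField.frobeniusAlgHom Fq R z := fun z => by simp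
    rw [pow_succ, pow_mul, pow_mul, pow_mul, ih, h, h, h, map_add]

section Local
variable {Fq : Type u} [Field Fq] (ϖ : Fq[X])

/-- The prime ideal `℘ = (ϖ)` of `A = F_q[T]`. -/
def primeSpot [h : Fact (Irreducible ϖ)] : HeightOneSpectrum Fq[X] where
  asIdeal := Ideal.span {ϖ}
  isPrime := (Ideal.span_singleton_prime h.out.ne_zero).2 h.out.prime
  ne_bot := by simpa using h.out.ne_zero

theorem one_lt_residueCard [Finite Fq] [h : Fact (Irreducible ϖ)] :
    (1 : NNReal) < (Nat.card Fq : NNReal) ^ ϖ.natDegree :=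
  one_lt_pow₀ (by exact_mod_cast Finite.one_lt_card) h.out.natDegree_pos.ne'

variable [Finite Fq] [Fact (Irreducible ϖ)]

/-- The fraction field of `A_℘`, i.e. the `℘`-adic completion of `F_q(T)`. -/
abbrev LocalField : Type u := (primeSpot ϖ).adicCompletion (RatFunc Fq)

/-- The `℘`-adic completion `A_℘` of `A`, as the valuation ring of `LocalField ϖ`. -/
abbrev LocalIntegers : ValuationSubring (LocalField ϖ) :=
  (primeSpot ϖ).adicCompletionIntegers (RatFunc Fq)

/-- Normalisation of the absolute value: `|ϖ| = q ^ (-d)`, where `d = deg ϖ`. -/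
instance LocalField.rankOne :
    (Valued.v : Valuation (LocalField ϖ) ℤᵐ⁰).RankOne :=
  Valuation.IsRankOneDiscrete.rankOne _ (one_lt_residueCard ϖ)

instance LocalField.normedField : NormedField (LocalField ϖ) :=
  Valued.toNormedField (LocalField ϖ) ℤᵐ⁰

instance LocalField.isUltrametricDist : IsUltrametricDist (LocalField ϖ) :=
  inferInstanceAs
    (@IsUltrametricDist (LocalField ϖ) (Valued.toNormedField (LocalField ϖ) ℤᵐ⁰).toDist)

theorem LocalField.norm_lt_one_iff (x : LocalField ϖ) :
    ‖x‖ < 1 ↔ Valued.v x < (1 : ℤᵐ⁰) :=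
  Valued.toNormedField.norm_lt_one_iff

theorem LocalField.norm_le_one_iff (x : LocalField ϖ) :
    ‖x‖ ≤ 1 ↔ Valued.v x ≤ (1 : ℤᵐ⁰) :=
  Valued.toNormedField.norm_le_one_iff

theorem LocalField.norm_algebraMap_lt_one_iff (a : Fq[X]) :
    ‖algebraMap Fq[X] (LocalField ϖ) a‖ < 1 ↔ ϖ ∣ a := by
  rw [LocalField.norm_lt_one_iff, IsScalarTower.algebraMap_apply Fq[X] (RatFunc Fq)]
  have := HeightOneSpectrum.valuedAdicCompletion_eq_valuation' (primeSpot ϖ)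
    (algebraMap Fq[X] (RatFunc Fq) a)
  rw [HeightOneSpectrum.algebraMap_adicCompletion, Function.comp_apply, Algebra.algebraMap_self,
    RingHom.id_apply, this, HeightOneSpectrum.valuation_lt_one_iff_mem]
  exact Ideal.mem_span_singleton

instance LocalField.nontriviallyNormedField : NontriviallyNormedField (LocalField ϖ) where
  __ := LocalField.normedField ϖ
  non_trivial := by
    have h := (LocalField.norm_algebraMap_lt_one_iff ϖ ϖ).2 dvd_rfl
    refine ⟨(algebraMap Fq[X] (LocalField ϖ) ϖ)⁻¹, ?_⟩
    rw [norm_inv]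
    refine (one_lt_inv₀ (norm_pos_iff.2 ?_)).2 h
    rw [IsScalarTower.algebraMap_apply Fq[X] (RatFunc Fq)]
    have h0 : ϖ ≠ 0 := (Fact.out : Irreducible ϖ).ne_zero
    simpa using h0

/-- An algebraic closure of the fraction field of `A_℘`, with the unique extension of the
absolute value. -/
abbrev AlgClosureLocal : Type u := AlgebraicClosure (LocalField ϖ)

instance AlgClosureLocal.normedField : NormedField (AlgClosureLocal ϖ) :=
  spectralNorm.normedField (LocalField ϖ) _

instance AlgClosureLocal.normedAlgebra : NormedAlgebra (LocalField ϖ) (AlgClosureLocal ϖ) :=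
  spectralNorm.normedAlgebra _ _

/-- The field `ℂ_℘`, the completion of the algebraic closure of the fraction field of `A_℘`. -/
abbrev Cwp : Type u := UniformSpace.Completion (AlgClosureLocal ϖ)

/-- The inclusion `A_℘ → ℂ_℘`. -/
def LocalIntegers.toCwp : LocalIntegers ϖ →+* Cwp ϖ :=
  (algebraMap (LocalField ϖ) (Cwp ϖ)).comp (LocalIntegers ϖ).subtype

/-- The inclusion `A → A_℘ → ℂ_℘`. -/
def polyToCwp : Fq[X] →+* Cwp ϖ :=
  (LocalIntegers.toCwp ϖ).comp (algebraMap Fq[X] (LocalIntegers ϖ))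

/-- The structure map `F_q → A_℘`. -/
def constToLocalIntegers : Fq →+* LocalIntegers ϖ :=
  (algebraMap Fq[X] (LocalIntegers ϖ)).comp C

/-- The subfield `F` of `A_℘` isomorphic to `A / ℘`: the elements with `x ^ (q ^ d) = x`. -/
def coeffSubfield : Subring (LocalIntegers ϖ) where
  carrier := {x | x ^ (Nat.card Fq ^ ϖ.natDegree) = x}
  mul_mem' {x y} hx hy := by
    simp only [Set.mem_ofPred_eq] at *
    rw [mul_pow, hx, hy]
  one_mem' := by simp
  add_mem' {x y} hx hy := by
    simp only [Set.mem_ofPred_eq] at *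
    rw [add_pow_card_pow (constToLocalIntegers ϖ), hx, hy]
  zero_mem' := by simp [(Nat.card_pos (α := Fq)).ne']
  neg_mem' {x} hx := by
    simp only [Set.mem_ofPred_eq] at *
    have h := add_pow_card_pow (constToLocalIntegers ϖ) ϖ.natDegree x (-x)
    rw [hx, add_neg_cancel, zero_pow (by simp [(Nat.card_pos (α := Fq)).ne'])] at h
    exact (neg_eq_of_add_eq_zero_right h.symm).symm

/-- The composite `F ⊂ A_℘ → A_℘ / ℘ A_℘`. -/
def residueMap : coeffSubfield ϖ →+* IsLocalRing.ResidueField (LocalIntegers ϖ) :=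
  (IsLocalRing.residue (LocalIntegers ϖ)).comp (coeffSubfield ϖ).subtype

theorem dvd_pow_card_sub (c : Fq[X]) :
    ϖ ∣ c ^ (Nat.card Fq ^ ϖ.natDegree) - c := by
  let : Field (AdjoinRoot ϖ) := AdjoinRoot.instField
  have h0 : ϖ ≠ 0 := (Fact.out : Irreducible ϖ).ne_zero
  have pb := AdjoinRoot.powerBasis h0
  have : Module.Finite Fq (AdjoinRoot ϖ) := (AdjoinRoot.powerBasis h0).finite
  have : Finite (AdjoinRoot ϖ) := Module.finite_of_finite Fq
  let := Fintype.ofFinite (AdjoinRoot ϖ)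
  have hc : Fintype.card (AdjoinRoot ϖ) = Nat.card Fq ^ ϖ.natDegree := by
    rw [← Nat.card_eq_fintype_card, Module.natCard_eq_pow_finrank (K := Fq),
      (AdjoinRoot.powerBasis h0).finrank, AdjoinRoot.powerBasis_dim]
  rw [← AdjoinRoot.mk_eq_zero, map_sub, map_pow, ← hc, FiniteField.pow_card, sub_self]

theorem LocalField.exists_poly_near (a : LocalField ϖ) (ha : ‖a‖ ≤ 1) :
    ∃ c : Fq[X], ‖a - algebraMap Fq[X] (LocalField ϖ) c‖ < 1 := by
  obtain ⟨b, hb⟩ := (HeightOneSpectrum.denseRange_algebraMap (K := RatFunc Fq)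
    (v := primeSpot ϖ)).exists_dist_lt a one_pos
  rw [dist_eq_norm] at hb
  have hb1 : ‖algebraMap (RatFunc Fq) (LocalField ϖ) b‖ ≤ 1 := by
    have := IsUltrametricDist.norm_add_le_max a (-(a - algebraMap (RatFunc Fq) (LocalField ϖ) b))
    rw [← sub_eq_add_neg, sub_sub_cancel, norm_neg] at this
    exact this.trans (max_le ha hb.le)
  have key : ∀ z : RatFunc Fq, Valued.v (algebraMap (RatFunc Fq) (LocalField ϖ) z)
      = (primeSpot ϖ).valuation (RatFunc Fq) z := fun z => by
    rw [HeightOneSpectrum.algebraMap_adicCompletion]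
    exact HeightOneSpectrum.valuedAdicCompletion_eq_valuation' _ _
  rw [LocalField.norm_le_one_iff, key] at hb1
  obtain ⟨c, hc⟩ := HeightOneSpectrum.exists_valuation_sub_lt_of_integer (primeSpot ϖ) hb1 1
  refine ⟨c, ?_⟩
  rw [Units.val_one, ← key, ← LocalField.norm_lt_one_iff, map_sub,
    ← IsScalarTower.algebraMap_apply] at hc
  rw [← sub_add_sub_cancel a (algebraMap (RatFunc Fq) (LocalField ϖ) b)]
  refine (IsUltrametricDist.norm_add_le_max _ _).trans_lt (max_lt hb ?_)
  rwa [norm_sub_rev]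

theorem LocalField.norm_pow_card_sub_lt (a : LocalField ϖ) (ha : ‖a‖ ≤ 1) :
    ‖a ^ (Nat.card Fq ^ ϖ.natDegree) - a‖ < 1 := by
  obtain ⟨c, hc⟩ := LocalField.exists_poly_near ϖ a ha
  set c' := algebraMap Fq[X] (LocalField ϖ) c
  set Q := Nat.card Fq ^ ϖ.natDegree with hQ
  have hQ0 : Q ≠ 0 := by simp [hQ, (Nat.card_pos (α := Fq)).ne']
  have h1 : ‖c' ^ Q - c'‖ < 1 := by
    rw [← map_pow, ← map_sub, LocalField.norm_algebraMap_lt_one_iff]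
    exact dvd_pow_card_sub ϖ c
  have h2 : a ^ Q = (a - c') ^ Q + c' ^ Q := by
    have := add_pow_card_pow ((algebraMap Fq[X] (LocalField ϖ)).comp C) ϖ.natDegree (a - c') c'
    rwa [sub_add_cancel] at this
  have h3 : a ^ Q - a = ((a - c') ^ Q - (a - c')) + (c' ^ Q - c') := by rw [h2]; ring
  rw [h3]
  refine (IsUltrametricDist.norm_add_le_max _ _).trans_lt (max_lt ?_ h1)
  rw [sub_eq_add_neg]
  refine (IsUltrametricDist.norm_add_le_max _ _).trans_lt (max_lt ?_ (by rwa [norm_neg]))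
  rw [norm_pow]
  exact pow_lt_one₀ (norm_nonneg _) hc hQ0

theorem LocalField.exists_teichmuller (a : LocalField ϖ) (ha : ‖a‖ ≤ 1) :
    ∃ x : LocalField ϖ, x ^ (Nat.card Fq ^ ϖ.natDegree) = x ∧ ‖x - a‖ < 1 := by
  set Q := Nat.card Fq ^ ϖ.natDegree with hQ
  have hQ1 : 1 < Q := Nat.one_lt_pow (Fact.out : Irreducible ϖ).natDegree_pos.ne'
    Finite.one_lt_card
  have hδ := LocalField.norm_pow_card_sub_lt ϖ a ha
  rw [← hQ] at hδ
  set δ := a ^ Q - a with hδd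
  have hsub : ∀ x y : LocalField ϖ, x ^ Q - y ^ Q = (x - y) ^ Q := fun x y => by
    have := add_pow_card_pow ((algebraMap Fq[X] (LocalField ϖ)).comp C) ϖ.natDegree (x - y) y
    rw [sub_add_cancel, ← hQ] at this
    rw [this]; ring
  let u : ℕ → LocalField ϖ := fun n => a ^ Q ^ n
  have hu : ∀ n, u (n + 1) = u n ^ Q := fun n => by simp only [u, pow_succ, pow_mul]
  have hstep : ∀ n, u (n + 1) - u n = δ ^ Q ^ n := by
    intro n
    induction n with
    | zero => simp [u, hδd]
    | succ n ih => rw [hu (n + 1), hu n, hsub, ← hu, ih, pow_succ, pow_mul]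
  have hc : CauchySeq u := by
    refine cauchySeq_of_le_geometric ‖δ‖ 1 hδ fun n => ?_
    rw [dist_comm, dist_eq_norm, hstep, norm_pow, one_mul]
    exact pow_le_pow_of_le_one (norm_nonneg _) hδ.le (Nat.lt_pow_self hQ1).le
  obtain ⟨x, hx⟩ := cauchySeq_tendsto_of_complete hc
  have hdist : ∀ n, ‖u n - a‖ ≤ ‖δ‖ := by
    intro n
    induction n with
    | zero => simp [u]
    | succ n ih =>
      rw [← sub_add_sub_cancel (u (n + 1)) (u n) a, hstep]
      refine (IsUltrametricDist.norm_add_le_max _ _).trans (max_le ?_ ih)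
      rw [norm_pow]
      exact pow_le_of_le_one (norm_nonneg _) hδ.le (pow_ne_zero _ (by omega))
  have h1 : Filter.Tendsto (fun n => u (n + 1)) Filter.atTop (nhds (x ^ Q)) := by
    simp_rw [hu]; exact hx.pow Q
  have h2 : Filter.Tendsto (fun n => u (n + 1)) Filter.atTop (nhds x) :=
    (Filter.tendsto_add_atTop_iff_nat 1).2 hx
  refine ⟨x, tendsto_nhds_unique h1 h2, ?_⟩
  · exact (le_of_tendsto (hx.sub_const a).norm (Filter.Eventually.of_forall hdist)).trans_lt hδ

theorem residue_eq_iff (x y : LocalIntegers ϖ) :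
    IsLocalRing.residue (LocalIntegers ϖ) x = IsLocalRing.residue (LocalIntegers ϖ) y ↔
      ‖(x : LocalField ϖ) - y‖ < 1 := by
  rw [← sub_eq_zero, ← map_sub, IsLocalRing.residue_eq_zero_iff, LocalField.norm_lt_one_iff]
  exact Valuation.mem_maximalIdeal_iff _ _

theorem residueMap_bijective : Function.Bijective (residueMap ϖ) := by
  have hQ1 : 1 < Nat.card Fq ^ ϖ.natDegree :=
    Nat.one_lt_pow (Fact.out : Irreducible ϖ).natDegree_pos.ne' Finite.one_lt_card
  constructor
  · rw [injective_iff_map_eq_zero]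
    rintro ⟨x, hx⟩ h
    have h' : ‖(x : LocalField ϖ)‖ < 1 := by
      have := (residue_eq_iff ϖ x 0).1 (by rw [map_zero]; exact h)
      simpa using this
    have hx' : (x : LocalField ϖ) ^ (Nat.card Fq ^ ϖ.natDegree) = x :=
      congrArg Subtype.val (show x ^ _ = x from hx)
    have : (x : LocalField ϖ) = 0 := by
      by_contra h0
      have h2 := congrArg norm hx'
      rw [norm_pow] at h2
      have := pow_lt_self_of_lt_one₀ (norm_pos_iff.2 h0) h' hQ1
      exact absurd h2 this.ne
    exact Subtype.ext (Subtype.ext this)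
  · intro y
    obtain ⟨a, rfl⟩ := IsLocalRing.residue_surjective y
    obtain ⟨x, hx, hxa⟩ := LocalField.exists_teichmuller ϖ a
      ((LocalField.norm_le_one_iff ϖ _).2 a.2)
    have hx1 : ‖x‖ ≤ 1 := by
      rw [← sub_add_cancel x (a : LocalField ϖ)]
      exact (IsUltrametricDist.norm_add_le_max _ _).trans
        (max_le hxa.le ((LocalField.norm_le_one_iff ϖ _).2 a.2))
    refine ⟨⟨⟨x, (LocalField.norm_le_one_iff ϖ _).1 hx1⟩, Subtype.ext hx⟩, ?_⟩
    exact (residue_eq_iff ϖ _ _).2 hxa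

/-- The isomorphism `ι : F ≃ A_℘ / ℘ A_℘`. -/
def iota : coeffSubfield ϖ ≃+* IsLocalRing.ResidueField (LocalIntegers ϖ) :=
  RingEquiv.ofBijective (residueMap ϖ) (residueMap_bijective ϖ)

/-- The composite `A → A_℘ → A_℘ / ℘ A_℘ → F`, the last map being the inverse of `iota`. -/
def polyToCoeffSubfield : Fq[X] →+* coeffSubfield ϖ :=
  (iota ϖ).symm.toRingHom.comp
    ((IsLocalRing.residue (LocalIntegers ϖ)).comp (algebraMap Fq[X] (LocalIntegers ϖ)))

end Local

section GaEnd

/-- Additivity `p(X + Y) = p(X) + p(Y)`. -/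
def IsAdditivePoly {R : Type u} [CommRing R] (p : R[X]) : Prop :=
  aeval (MvPolynomial.X 0 + MvPolynomial.X 1 : MvPolynomial (Fin 2) R) p =
    aeval (MvPolynomial.X 0 : MvPolynomial (Fin 2) R) p +
      aeval (MvPolynomial.X 1 : MvPolynomial (Fin 2) R) p

theorem IsAdditivePoly.aeval_add {R : Type u} [CommRing R] {p : R[X]} (h : IsAdditivePoly p)
    {S : Type*} [CommRing S] [Algebra R S] (x y : S) :
    aeval (x + y) p = aeval x p + aeval y p := by
  have h' := congrArg (MvPolynomial.aeval ![x, y] : MvPolynomial (Fin 2) R →ₐ[R] S) h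
  simpa [← Polynomial.aeval_algHom_apply] using h'

/-- Endomorphisms of the additive group scheme over `R`: additive polynomials. They form a ring
under addition and composition. -/
@[ext]
structure GaEnd (R : Type u) [CommRing R] where
  poly : R[X]
  additive : IsAdditivePoly poly

namespace GaEnd

variable {R : Type u} [CommRing R]

theorem aeval_add (p : GaEnd R) {S : Type*} [CommRing S] [Algebra R S] (x y : S) :
    aeval (x + y) p.poly = aeval x p.poly + aeval y p.poly :=
  p.additive.aeval_add x y

theorem aeval_zero (p : GaEnd R) {S : Type*} [CommRing S] [Algebra R S] :
    aeval (0 : S) p.poly = 0 := by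
  have h := p.aeval_add (0 : S) 0
  rw [add_zero] at h
  simpa using h

theorem aeval_neg (p : GaEnd R) {S : Type*} [CommRing S] [Algebra R S] (x : S) :
    aeval (-x) p.poly = -aeval x p.poly := by
  have h := p.aeval_add x (-x)
  rw [add_neg_cancel, p.aeval_zero] at h
  exact (neg_eq_of_add_eq_zero_right h.symm).symm

instance : Zero (GaEnd R) := ⟨⟨0, by simp [IsAdditivePoly]⟩⟩
instance : One (GaEnd R) := ⟨⟨X, by simp [IsAdditivePoly]⟩⟩
instance : Add (GaEnd R) :=
  ⟨fun p q => ⟨p.poly + q.poly, by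
    simp only [IsAdditivePoly, map_add, p.aeval_add, q.aeval_add]; ring⟩⟩
instance : Neg (GaEnd R) :=
  ⟨fun p => ⟨-p.poly, by simp only [IsAdditivePoly, map_neg, p.aeval_add]; ring⟩⟩
instance : Mul (GaEnd R) :=
  ⟨fun p q => ⟨p.poly.comp q.poly, by
    simp only [IsAdditivePoly, aeval_comp, q.aeval_add, p.aeval_add]⟩⟩

@[simp] theorem poly_zero : (0 : GaEnd R).poly = 0 := rfl
@[simp] theorem poly_one : (1 : GaEnd R).poly = X := rfl
@[simp] theorem poly_add (p q : GaEnd R) : (p + q).poly = p.poly + q.poly := rfl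
@[simp] theorem poly_neg (p : GaEnd R) : (-p).poly = -p.poly := rfl
@[simp] theorem poly_mul (p q : GaEnd R) : (p * q).poly = p.poly.comp q.poly := rfl

instance : Ring (GaEnd R) where
  add_assoc _ _ _ := GaEnd.ext (add_assoc _ _ _)
  zero_add _ := GaEnd.ext (zero_add _)
  add_zero _ := GaEnd.ext (add_zero _)
  add_comm _ _ := GaEnd.ext (add_comm _ _)
  neg_add_cancel _ := GaEnd.ext (neg_add_cancel _)
  mul_assoc _ _ _ := GaEnd.ext (comp_assoc _ _ _)
  one_mul _ := GaEnd.ext (by simp)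
  mul_one _ := GaEnd.ext (by simp)
  zero_mul _ := GaEnd.ext (by simp)
  mul_zero p := GaEnd.ext (by simpa [aeval_def, comp] using p.aeval_zero (S := R[X]))
  left_distrib p q r := GaEnd.ext (by
    simpa [aeval_def, comp] using p.aeval_add (S := R[X]) q.poly r.poly)
  right_distrib _ _ _ := GaEnd.ext (by simp)
  nsmul := nsmulRec
  zsmul := zsmulRec

/-- The ring homomorphism `R → End(𝔾_a)` sending `a` to the endomorphism `X ↦ a X`. -/
def scalar : R →+* GaEnd R where
  toFun a := ⟨C a * X, by simp [IsAdditivePoly, mul_add]⟩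
  map_zero' := GaEnd.ext (by simp)
  map_one' := GaEnd.ext (by simp)
  map_add' _ _ := GaEnd.ext (by simp [add_mul])
  map_mul' _ _ := GaEnd.ext (by simp [mul_assoc])

end GaEnd
end GaEnd

section ModuleScheme

/-- An (affine) `A`-module scheme over `O`, through its functor of points: an affine scheme
`Spec S` over `O` with an `A`-module structure on the set `Hom_O(S, R)` of `R`-valued points,
functorial in the `O`-algebra `R`. -/
structure ModuleScheme (A : Type u) [CommRing A] (O : Type u) [CommRing O] where
  coordRing : Type u
  [commRing : CommRing coordRing]
  [algebra : Algebra O coordRing]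
  [addCommGroup : ∀ (R : Type u) [CommRing R] [Algebra O R], AddCommGroup (coordRing →ₐ[O] R)]
  [module : ∀ (R : Type u) [CommRing R] [Algebra O R], Module A (coordRing →ₐ[O] R)]
  comp_add : ∀ {R R' : Type u} [CommRing R] [Algebra O R] [CommRing R'] [Algebra O R']
    (f : R →ₐ[O] R') (x y : coordRing →ₐ[O] R), f.comp (x + y) = f.comp x + f.comp y
  comp_smul : ∀ {R R' : Type u} [CommRing R] [Algebra O R] [CommRing R'] [Algebra O R']
    (f : R →ₐ[O] R') (a : A) (x : coordRing →ₐ[O] R), f.comp (a • x) = a • f.comp x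

namespace ModuleScheme

attribute [instance] commRing algebra addCommGroup module

variable {A O : Type u} [CommRing A] [CommRing O]

/-- The `R`-valued points. -/
abbrev Points (G : ModuleScheme A O) (R : Type u) [CommRing R] [Algebra O R] : Type u :=
  G.coordRing →ₐ[O] R

/-- An isomorphism `G → H` of `A`-module schemes over `O`: an isomorphism of schemes over `O`
(given on coordinate rings) that is `A`-linear on `R`-valued points for every `R`. -/
structure Iso (G H : ModuleScheme A O) where
  toAlgEquiv : H.coordRing ≃ₐ[O] G.coordRing
  map_add : ∀ (R : Type u) [CommRing R] [Algebra O R] (x y : G.Points R),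
    (x + y).comp toAlgEquiv.toAlgHom = x.comp toAlgEquiv.toAlgHom + y.comp toAlgEquiv.toAlgHom
  map_smul : ∀ (R : Type u) [CommRing R] [Algebra O R] (a : A) (x : G.Points R),
    (a • x).comp toAlgEquiv.toAlgHom = a • x.comp toAlgEquiv.toAlgHom

/-- A closed `A`-submodule scheme: a closed subscheme `V(I)` whose `R`-valued points form an
`A`-submodule of the `R`-valued points of `G` for every `R`. -/
structure ClosedSubmodule (G : ModuleScheme A O) where
  ideal : Ideal G.coordRing
  points : ∀ (R : Type u) [CommRing R] [Algebra O R], Submodule A (G.Points R)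
  mem_points : ∀ (R : Type u) [CommRing R] [Algebra O R] (x : G.Points R),
    x ∈ points R ↔ ∀ f ∈ ideal, x f = 0

namespace ClosedSubmodule

variable {G : ModuleScheme A O} (H : ClosedSubmodule G)

/-- Points of `V(I)`, as algebra maps out of the quotient by `I`. -/
def pointsEquiv (R : Type u) [CommRing R] [Algebra O R] :
    (G.coordRing ⧸ H.ideal →ₐ[O] R) ≃ H.points R where
  toFun x := ⟨x.comp (Ideal.Quotient.mkₐ O H.ideal), (H.mem_points R _).2 fun f hf => by
    simp [Ideal.Quotient.eq_zero_iff_mem.2 hf]⟩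
  invFun x := Ideal.Quotient.liftₐ H.ideal x.1 ((H.mem_points R x.1).1 x.2)
  left_inv x := by
    apply Ideal.Quotient.algHom_ext
    rfl
  right_inv x := by
    rfl

instance (R : Type u) [CommRing R] [Algebra O R] :
    AddCommGroup (G.coordRing ⧸ H.ideal →ₐ[O] R) := (H.pointsEquiv R).addCommGroup

instance (R : Type u) [CommRing R] [Algebra O R] :
    Module A (G.coordRing ⧸ H.ideal →ₐ[O] R) := (H.pointsEquiv R).module A

theorem pointsEquiv_add (R : Type u) [CommRing R] [Algebra O R]
    (x y : G.coordRing ⧸ H.ideal →ₐ[O] R) :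
    H.pointsEquiv R (x + y) = H.pointsEquiv R x + H.pointsEquiv R y :=
  (H.pointsEquiv R).apply_symm_apply _

theorem pointsEquiv_smul (R : Type u) [CommRing R] [Algebra O R] (a : A)
    (x : G.coordRing ⧸ H.ideal →ₐ[O] R) :
    H.pointsEquiv R (a • x) = a • H.pointsEquiv R x :=
  (H.pointsEquiv R).apply_symm_apply _

theorem pointsEquiv_comp {R R' : Type u} [CommRing R] [Algebra O R] [CommRing R'] [Algebra O R']
    (f : R →ₐ[O] R') (x : G.coordRing ⧸ H.ideal →ₐ[O] R) :
    (H.pointsEquiv R' (f.comp x) : G.Points R') = f.comp (H.pointsEquiv R x : G.Points R) := rfl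

/-- A closed `A`-submodule scheme as an `A`-module scheme in its own right. -/
def toModuleScheme : ModuleScheme A O where
  coordRing := G.coordRing ⧸ H.ideal
  comp_add f x y := by
    apply (H.pointsEquiv _).injective
    apply Subtype.ext
    simp only [pointsEquiv_add, pointsEquiv_comp, Submodule.coe_add, G.comp_add]
  comp_smul f a x := by
    apply (H.pointsEquiv _).injective
    apply Subtype.ext
    simp only [pointsEquiv_smul, pointsEquiv_comp, Submodule.coe_smul, G.comp_smul]

end ClosedSubmodule

section Ga

variable (ρ : A →+* GaEnd O)

/-- The points of the additive group `Spec O[X]` with values in `R` are the elements of `R`. -/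
def gaPointsEquiv (R : Type u) [CommRing R] [Algebra O R] : (O[X] →ₐ[O] R) ≃ R where
  toFun x := x X
  invFun x := aeval x
  left_inv x := by ext; simp
  right_inv x := by simp

/-- The group structure of the additive group on points. -/
@[reducible]
def gaAddCommGroup (R : Type u) [CommRing R] [Algebra O R] : AddCommGroup (O[X] →ₐ[O] R) :=
  (gaPointsEquiv R).addCommGroup

theorem gaPointsEquiv_add (R : Type u) [CommRing R] [Algebra O R] (x y : O[X] →ₐ[O] R) :
    gaPointsEquiv R ((gaAddCommGroup R).add x y) = gaPointsEquiv R x + gaPointsEquiv R y :=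
  (gaPointsEquiv R).apply_symm_apply _

theorem gaPointsEquiv_zero (R : Type u) [CommRing R] [Algebra O R] :
    gaPointsEquiv (O := O) R (gaAddCommGroup R).zero = 0 :=
  (gaPointsEquiv R).apply_symm_apply _

/-- The action of `a : A` on points of the additive group, `x ↦ ρ_a(x)`. -/
@[reducible]
def gaModule (R : Type u) [CommRing R] [Algebra O R] :
    @Module A (O[X] →ₐ[O] R) _ (gaAddCommGroup R).toAddCommMonoid :=
  letI := gaAddCommGroup (O := O) R
  { smul := fun a x => (gaPointsEquiv R).symm (aeval (gaPointsEquiv R x) (ρ a).poly)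
    one_smul := fun x => (gaPointsEquiv R).injective <|
      ((gaPointsEquiv R).apply_symm_apply _).trans <| by simp
    mul_smul := fun a b x => (gaPointsEquiv R).injective <|
      ((gaPointsEquiv R).apply_symm_apply _).trans <| Eq.symm <|
      ((gaPointsEquiv R).apply_symm_apply _).trans <| by
        rw [map_mul, GaEnd.poly_mul, aeval_comp]
        exact congrArg (fun z => aeval z (ρ a).poly) ((gaPointsEquiv R).apply_symm_apply _)
    smul_zero := fun a => (gaPointsEquiv R).injective <|
      ((gaPointsEquiv R).apply_symm_apply _).trans <| by
        refine (congrArg (fun z => aeval z (ρ a).poly) (gaPointsEquiv_zero R)).trans ?_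
        exact ((ρ a).aeval_zero).trans (gaPointsEquiv_zero R).symm
    smul_add := fun a x y => (gaPointsEquiv R).injective <|
      ((gaPointsEquiv R).apply_symm_apply _).trans <| by
        refine (congrArg (fun z => aeval z (ρ a).poly) (gaPointsEquiv_add R x y)).trans ?_
        refine ((ρ a).aeval_add _ _).trans (Eq.symm ((gaPointsEquiv_add R _ _).trans ?_))
        exact congrArg₂ (· + ·) ((gaPointsEquiv R).apply_symm_apply _)
          ((gaPointsEquiv R).apply_symm_apply _)
    add_smul := fun a b x => (gaPointsEquiv R).injective <|
      ((gaPointsEquiv R).apply_symm_apply _).trans <| by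
        rw [map_add, GaEnd.poly_add, map_add]
        refine Eq.symm ((gaPointsEquiv_add R _ _).trans ?_)
        exact congrArg₂ (· + ·) ((gaPointsEquiv R).apply_symm_apply _)
          ((gaPointsEquiv R).apply_symm_apply _)
    zero_smul := fun x => (gaPointsEquiv R).injective <|
      ((gaPointsEquiv R).apply_symm_apply _).trans <| by
        rw [map_zero, GaEnd.poly_zero, map_zero]
        exact (gaPointsEquiv_zero R).symm }

/-- The additive group over `O` with the `A`-module structure given by a ring homomorphism
`ρ : A → End(𝔾_a)`. -/
def ga : ModuleScheme A O where
  coordRing := O[X]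
  addCommGroup R _ _ := gaAddCommGroup R
  module R _ _ := gaModule ρ R
  comp_add f x y := (gaPointsEquiv _).injective <| by
    refine Eq.trans ?_ (gaPointsEquiv_add _ _ _).symm
    exact (congrArg f (gaPointsEquiv_add _ x y)).trans (map_add f _ _)
  comp_smul f a x := (gaPointsEquiv _).injective <| by
    refine Eq.trans ?_ ((gaPointsEquiv _).apply_symm_apply _).symm
    refine (congrArg f ((gaPointsEquiv _).apply_symm_apply _)).trans ?_
    exact (aeval_algHom_apply f _ _).symm

variable {ρ} in
/-- The coordinate in `R` of an `R`-valued point of the additive group. -/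
def coord {R : Type u} [CommRing R] [Algebra O R] (x : (ga ρ).Points R) : R :=
  gaPointsEquiv R x

theorem coord_add {R : Type u} [CommRing R] [Algebra O R] (x y : (ga ρ).Points R) :
    coord (x + y) = coord x + coord y := gaPointsEquiv_add R x y

theorem coord_zero {R : Type u} [CommRing R] [Algebra O R] :
    coord (0 : (ga ρ).Points R) = 0 := gaPointsEquiv_zero R

theorem coord_smul {R : Type u} [CommRing R] [Algebra O R] (a : A) (x : (ga ρ).Points R) :
    coord (a • x) = aeval (coord x) (ρ a).poly := (gaPointsEquiv R).apply_symm_apply _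

theorem apply_eq_aeval_coord {R : Type u} [CommRing R] [Algebra O R] (x : (ga ρ).Points R)
    (f : O[X]) : (show O[X] →ₐ[O] R from x) f = aeval (coord x) f :=
  (DFunLike.congr_fun ((gaPointsEquiv R).symm_apply_apply x) f).symm

/-- The closed `A`-submodule scheme `Spec O[X]/(p)` of `(𝔾_a, ρ)`, the kernel of an additive
polynomial `p` that commutes with the action `ρ`. -/
def gaKernel (p : GaEnd O) (hp : ∀ a, p * ρ a = ρ a * p) : ClosedSubmodule (ga ρ) where
  ideal := (Ideal.span {p.poly} : Ideal O[X])
  points R _ _ :=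
    { carrier := {x | aeval (coord x) p.poly = 0}
      zero_mem' := by
        rw [Set.mem_ofPred_eq, coord_zero, p.aeval_zero]
      add_mem' := fun {x y} hx hy => by
        rw [Set.mem_ofPred_eq] at *
        rw [coord_add, p.aeval_add, hx, hy, add_zero]
      smul_mem' := fun a x hx => by
        rw [Set.mem_ofPred_eq] at *
        rw [coord_smul, ← aeval_comp, ← GaEnd.poly_mul, hp, GaEnd.poly_mul, aeval_comp, hx,
          (ρ a).aeval_zero] }
  mem_points R _ _ x := by
    constructor
    · intro hx f hf
      obtain ⟨g, rfl⟩ : ∃ g : O[X], g * p.poly = f := Ideal.mem_span_singleton'.1 hf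
      have h := apply_eq_aeval_coord ρ x (g * p.poly)
      refine h.trans ?_
      rw [map_mul, show aeval (coord x) p.poly = 0 from hx, mul_zero]
    · intro h
      exact (apply_eq_aeval_coord ρ x p.poly).symm.trans
        (h p.poly (Ideal.mem_span_singleton_self _))

end Ga
end ModuleScheme
end ModuleScheme

section Drinfeld

variable {Fq : Type u} [Field Fq] [Finite Fq] {ϖ : Fq[X]} [Fact (Irreducible ϖ)]

/-- The standing assumptions on the base ring `O ⊂ ℂ_℘`: it is a local ring whose maximal ideal
is `{x ∈ O : |x| < 1}`, it contains `A_℘`, it is complete, and every element of its fraction field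
of absolute value `< 1` lies in `O`. -/
structure IsBaseRing (O : Subring (Cwp ϖ)) : Prop where
  isLocalRing : IsLocalRing O
  mem_maximalIdeal_iff : ∀ x : O, x ∈ IsLocalRing.maximalIdeal O ↔ ‖(x : Cwp ϖ)‖ < 1
  toCwp_mem : ∀ a : LocalIntegers ϖ, LocalIntegers.toCwp ϖ a ∈ O
  isComplete : IsComplete (O : Set (Cwp ϖ))
  div_mem : ∀ x ∈ O, ∀ y ∈ O, ‖x‖ < ‖y‖ → x / y ∈ O

/-- Drinfeld modules of rank `r` over `O` (with underlying group scheme `𝔾_a`): ring homomorphisms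
`φ : A → End(𝔾_a)` with derivative the structure map `A → O`, such that for `a ≠ 0` the polynomial
`φ_a` has degree `q ^ (r deg a)` and its leading coefficient is a unit. -/
structure DrinfeldModule (O : Subring (Cwp ϖ)) (r : ℕ) where
  toRingHom : Fq[X] →+* GaEnd O
  coeff_one : ∀ a, (((toRingHom a).poly.coeff 1 : O) : Cwp ϖ) = polyToCwp ϖ a
  natDegree_eq : ∀ a, a ≠ 0 → (toRingHom a).poly.natDegree = Nat.card Fq ^ (r * a.natDegree)
  isUnit_leadingCoeff : ∀ a, a ≠ 0 → IsUnit (toRingHom a).poly.leadingCoeff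

namespace DrinfeldModule

variable {O : Subring (Cwp ϖ)} {r : ℕ} (φ : DrinfeldModule O r)

/-- The additive group over `O` with the `A`-action given by `φ`. -/
abbrev moduleScheme : ModuleScheme Fq[X] O := ModuleScheme.ga φ.toRingHom

/-- The torsion subscheme `φ[a] = Spec O[X]/(φ_a)`. -/
def torsion (a : Fq[X]) : φ.moduleScheme.ClosedSubmodule :=
  ModuleScheme.gaKernel φ.toRingHom (φ.toRingHom a) fun b => by
    rw [← map_mul, ← map_mul, mul_comm]

/-- The coefficient `H_i` of `X ^ (q ^ i)` in `φ_ϖ(X)`. -/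
def coeffH (i : ℕ) : O := (φ.toRingHom ϖ).poly.coeff (Nat.card Fq ^ i)

/-- `N` is the canonical submodule of `φ`: with `δ₀` the minimum of `|x|` over the nonzero
`x ∈ φ[ϖ](ℂ_℘)`, the set `N` consists of the `x ∈ φ[ϖ](ℂ_℘)` with `|x| ≤ δ₀`, and `N` is free of
rank one over `A / ℘` via `φ` (i.e. isomorphic to `A / ℘`). -/
def IsCanonicalSubmodule (N : Submodule Fq[X] (φ.moduleScheme.Points (Cwp ϖ))) : Prop :=
  ∃ δ₀ : ℝ,
    IsLeast {t : ℝ | ∃ x ∈ (φ.torsion ϖ).points (Cwp ϖ), x ≠ 0 ∧ ‖ModuleScheme.coord x‖ = t} δ₀ ∧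
    (∀ x, x ∈ N ↔ x ∈ (φ.torsion ϖ).points (Cwp ϖ) ∧ ‖ModuleScheme.coord x‖ ≤ δ₀) ∧
    Nonempty (N ≃ₗ[Fq[X]] (Fq[X] ⧸ (Ideal.span {ϖ} : Ideal Fq[X])))

/-- `H` is the canonical submodule scheme of `φ`: an `A`-submodule scheme of `φ[ϖ]`, flat over `O`
(it is then finite flat), whose `ℂ_℘`-valued points form the canonical submodule. -/
structure IsCanonicalSubmoduleScheme (H : φ.moduleScheme.ClosedSubmodule) : Prop where
  flat : Module.Flat O (φ.moduleScheme.coordRing ⧸ H.ideal)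
  le_torsion : (φ.torsion ϖ).ideal ≤ H.ideal
  isCanonicalSubmodule : φ.IsCanonicalSubmodule (H.points (Cwp ϖ))

end DrinfeldModule

variable {O : Subring (Cwp ϖ)} (hO : IsBaseRing O)

/-- The composite `A → A_℘ → A_℘ / ℘ A_℘ → F ⊂ A_℘ ⊂ O`, where the third map is the inverse of
`iota`. -/
def IsBaseRing.residueLift : Fq[X] →+* O :=
  ((LocalIntegers.toCwp ϖ).codRestrict O hO.toCwp_mem).comp
    ((coeffSubfield ϖ).subtype.comp (polyToCoeffSubfield ϖ))

/-- The action of `A` on `𝔾_a` through `A → F`, with `λ ∈ F` acting as `X ↦ λ X`. -/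
def IsBaseRing.scalarAction : Fq[X] →+* GaEnd O := GaEnd.scalar.comp hO.residueLift

/-- The additive polynomial `X ^ (q ^ d) + c X`. -/
def zPoly (c : O) : GaEnd O where
  poly := X ^ (Nat.card Fq ^ ϖ.natDegree) + C c * X
  additive := by
    have h := add_pow_card_pow (((algebraMap O (MvPolynomial (Fin 2) O)).comp hO.residueLift).comp C)
      ϖ.natDegree (MvPolynomial.X 0) (MvPolynomial.X 1)
    simp only [IsAdditivePoly, map_add, map_pow, map_mul, aeval_X, aeval_C, h]
    ring

/-- The group scheme `Z(c) = Spec O[X]/(X ^ (q ^ d) + c X)` with the `A`-action through `A → F`,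
where `λ ∈ F` acts as `X ↦ λ X`. -/
def Z (c : O) : (ModuleScheme.ga hO.scalarAction).ClosedSubmodule :=
  ModuleScheme.gaKernel hO.scalarAction (zPoly hO c) fun a => by
    have h : hO.residueLift a ^ (Nat.card Fq ^ ϖ.natDegree) = hO.residueLift a := by
      rw [IsBaseRing.residueLift, RingHom.comp_apply, ← map_pow, RingHom.comp_apply]
      exact congrArg _ (polyToCoeffSubfield ϖ a).2
    apply GaEnd.ext
    change (X ^ (Nat.card Fq ^ ϖ.natDegree) + C c * X : O[X]).comp (C (hO.residueLift a) * X) =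
      (C (hO.residueLift a) * X : O[X]).comp (X ^ (Nat.card Fq ^ ϖ.natDegree) + C c * X)
    simp only [add_comp, mul_comp, C_comp, X_comp, pow_comp, mul_pow, ← C_pow, h]
    ring

end Drinfeld

end

/-! Write Q = q^d, and call an element x with |x - 1| < 1 a 1-unit. Since the canonical submodule is
free of rank one over A/℘, the geometric points of C are elements m_c, c in A/℘, with φ_a(m_c) =
m_{ac} and |m_c| ≤ δ₀ < 1. Flatness forces the ideal of C to be generated by the monic polynomial P
= ∏ (X - m_c), and this ideal consists exactly of the polynomials vanishing at all m_c
(`IsBaseRing.exists_monic_span_eq`).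

The isomorphism comes from an explicit additive polynomial. Let b̃ in O be the Teichmüller lift of
b. The projector f = -∑ b̃⁻¹ φ_b, summed over the nonzero classes b, satisfies f(m_c) = c̃ y with y
= f(m_1) (`aeval_eigenProjector`), so it turns the A-action on points into the action through 𝔽 and
sends the m_c to the roots of X^Q - y^(Q-1) X. Its linear coefficient is congruent to -(Q - 1) = 1,
so f(x)/x is a 1-unit for every nonzero x in the open unit disc.

It remains to compare -y^(Q-1) with ϖ/H_d. Factor φ_ϖ = P R. All roots of R are larger than δ₀, so
H_d, the coefficient of X^Q, is R(0) times a 1-unit, while comparing linear coefficients gives ϖ =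
R(0) ∏ (-m_b) over b ≠ 0. Hence ϖ/H_d is ∏ m_b up to a 1-unit (`coeffH_estimate`). By Wilson's
theorem ∏ f(m_b) = -y^(Q-1), so ϖ/H_d = s · (-y^(Q-1)) with s a 1-unit of O. A (Q-1)-th root w of s
exists in O, and F = w f sends the m_c to the roots of X^Q + (ϖ/H_d) X (`exists_normalization`).

On coordinate rings F induces an injection, because both ideals are detected on geometric points,
and a surjection by Nakayama's lemma, because F has invertible linear coefficient
(`exists_sub_comp_mem`). -/

noncomputable section

/-! ### Ultrametric fields, Newton polygons, additive polynomials and ideals of `O[X]` -/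

section Fields

/-- A complete ultrametric field with a dense algebraically closed subfield is algebraically
closed, in any characteristic. -/
theorem isAlgClosed_of_denseRange_algebraMap {K L : Type*} [Field K] [NontriviallyNormedField L]
    [CompleteSpace L] [IsUltrametricDist L] [Algebra K L]
    (hi : DenseRange (algebraMap K L)) [IsAlgClosed K] : IsAlgClosed L := by
  apply IsAlgClosed.of_exists_root
  intro f fmon firr
  have fdeg : f.natDegree ≠ 0 := (Irreducible.natDegree_pos firr).ne'
  let F := f.SplittingField
  let : NormedField F := spectralNorm.normedField L F
  let : NormedAlgebra L F := spectralNorm.normedAlgebra L F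
  obtain ⟨a, ha⟩ : ∃ a : F, (f.map (algebraMap L F)).eval a = 0 :=
    (SplittingField.splits f).exists_eval_eq_zero
      (by simpa using degree_ne_of_natDegree_ne fdeg)
  have hcl : IsClosed (Set.range (algebraMap L F)) :=
    (algebraMap_isometry L F).isClosedEmbedding.isClosed_range
  -- The image of the complete field `L` is closed, so it suffices to approximate `a` by elements of
  -- `L`; roots of polynomials over `K` close to `f` provide them.
  have hmem : a ∈ Set.range (algebraMap L F) := by
    rw [← hcl.closure_eq, Metric.mem_closure_iff]
    intro ε hε
    set M := max ‖a‖ 1 with hM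
    have hM0 : 0 < M := lt_max_of_lt_right one_pos
    set n := f.natDegree with hn
    -- Chosen so that the continuity-of-roots bound `((n + 1) * η) ^ (1 / n) * M` is exactly `ε`.
    set η : ℝ := (ε / M) ^ n / (n + 1) with hη
    have hη0 : 0 < η := by positivity
    obtain ⟨g, hg, hgdeg, hgc⟩ :=
      exists_monic_and_natDegree_eq_and_norm_map_algebraMap_coeff_sub_lt hi fmon hη0
    obtain ⟨b, hb, hab⟩ := exists_roots_norm_sub_lt_of_norm_coeff_sub_lt (K := F)
      (f := f.map (algebraMap L F)) (g := (g.map (algebraMap K L)).map (algebraMap L F))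
      hη0 ha (fmon.map _) ((hg.map _).map _) (by simp [hgdeg])
      (fun i => by
        rw [coeff_map, coeff_map (p := f), ← map_sub, norm_algebraMap']
        simpa using hgc i)
      (((IsAlgClosed.splits g).map _).map _)
    have hb' : b ∈ Set.range (algebraMap L F) := by
      have h := (IsAlgClosed.splits g).roots_map (algebraMap K L)
      have h' := ((IsAlgClosed.splits g).map (algebraMap K L)).roots_map (algebraMap L F)
      rw [h'] at hb
      obtain ⟨z, -, rfl⟩ := Multiset.mem_map.1 hb
      exact ⟨z, rfl⟩
    refine ⟨b, hb', ?_⟩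
    rw [dist_eq_norm]
    refine hab.trans_eq ?_
    rw [natDegree_map, ← hn, hη, mul_div_cancel₀ _ (by positivity), Real.pow_rpow_inv_natCast
      (by positivity) fdeg, div_mul_cancel₀ _ hM0.ne']
  obtain ⟨x, rfl⟩ := hmem
  refine ⟨x, ?_⟩
  rw [eval_map_algebraMap, aeval_algebraMap_apply] at ha
  simpa using ha

theorem norm_sub_le_max_norm {K : Type*} [NormedField K] [IsUltrametricDist K] (a b : K) :
    ‖a - b‖ ≤ max ‖a‖ ‖b‖ := by
  simpa [sub_eq_add_neg] using IsUltrametricDist.norm_add_le_max a (-b)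

/-- The 1-units form a multiplicative group. The comparison of `ϖ / H_d` with the points of `C` is
carried out modulo this group. -/
theorem norm_mul_sub_one_lt {K : Type*} [NormedField K] [IsUltrametricDist K] {a b : K}
    (ha : ‖a - 1‖ < 1) (hb : ‖b - 1‖ < 1) : ‖a * b - 1‖ < 1 := by
  have h : a * b - 1 = ((a - 1) * (b - 1) + (a - 1)) + (b - 1) := by ring
  rw [h]
  refine (IsUltrametricDist.norm_add_le_max _ _).trans_lt (max_lt
    ((IsUltrametricDist.norm_add_le_max _ _).trans_lt (max_lt ?_ ha)) hb)
  rw [norm_mul]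
  exact mul_lt_one_of_nonneg_of_lt_one_left (norm_nonneg _) ha hb.le

theorem norm_eq_one_of_norm_sub_one_lt {K : Type*} [NormedField K] [IsUltrametricDist K] {a : K}
    (ha : ‖a - 1‖ < 1) : ‖a‖ = 1 := by
  have h := IsUltrametricDist.norm_add_eq_max_of_norm_ne_norm (x := a - 1) (y := 1)
    (by rw [norm_one]; exact ha.ne)
  rwa [sub_add_cancel, norm_one, max_eq_right ha.le] at h

theorem norm_inv_sub_one_lt {K : Type*} [NormedField K] [IsUltrametricDist K] {a : K}
    (ha : ‖a - 1‖ < 1) : ‖a⁻¹ - 1‖ < 1 := by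
  have h1 := norm_eq_one_of_norm_sub_one_lt ha
  have h0 : a ≠ 0 := by
    rintro rfl
    simp at h1
  have h : a⁻¹ - 1 = -(a⁻¹ * (a - 1)) := by field_simp; ring
  rwa [h, norm_neg, norm_mul, norm_inv, h1, inv_one, one_mul]

theorem norm_prod_sub_one_lt {K ι : Type*} [NormedField K] [IsUltrametricDist K] (s : Finset ι)
    (a : ι → K) (ha : ∀ i ∈ s, ‖a i - 1‖ < 1) : ‖∏ i ∈ s, a i - 1‖ < 1 := by
  classical
  induction s using Finset.induction_on with
  | empty => simp
  | insert i s hi ih =>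
    rw [Finset.prod_insert hi]
    exact norm_mul_sub_one_lt (ha i (Finset.mem_insert_self _ _))
      (ih fun j hj => ha j (Finset.mem_insert_of_mem hj))

/-- A polynomial all of whose roots are larger than `δ` is dominated by its constant term on the
disc of radius `δ`. -/
theorem norm_coeff_prod_X_sub_C_mul_pow_lt {K : Type*} [NormedField K] [IsUltrametricDist K]
    {δ : ℝ} (hδ : 0 ≤ δ) (s : Multiset K) (hs : ∀ x ∈ s, δ < ‖x‖) :
    0 < ‖(s.map fun x => X - C x).prod.coeff 0‖ ∧ ∀ j, j ≠ 0 →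
      ‖(s.map fun x => X - C x).prod.coeff j‖ * δ ^ j <
        ‖(s.map fun x => X - C x).prod.coeff 0‖ := by
  induction s using Multiset.induction_on with
  | empty =>
    simp only [Multiset.map_zero, Multiset.prod_zero, coeff_one_zero, norm_one, zero_lt_one,
      true_and]
    intro j hj
    simp [coeff_one, hj]
  | cons x s ih =>
    obtain ⟨h0, h⟩ := ih fun y hy => hs y (Multiset.mem_cons_of_mem hy)
    have hx : δ < ‖x‖ := hs x (Multiset.mem_cons_self _ _)
    have hx0 : 0 < ‖x‖ := hδ.trans_lt hx
    rw [Multiset.map_cons, Multiset.prod_cons]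
    set p := (s.map fun x => X - C x).prod
    have hc0 : ‖((X - C x) * p).coeff 0‖ = ‖x‖ * ‖p.coeff 0‖ := by simp [mul_coeff_zero]
    refine ⟨by rw [hc0]; positivity, fun j hj => ?_⟩
    rw [hc0]
    obtain ⟨j, rfl⟩ := Nat.exists_eq_succ_of_ne_zero hj
    have hle : ‖p.coeff j‖ * δ ^ j ≤ ‖p.coeff 0‖ := by
      rcases eq_or_ne j 0 with rfl | hj'
      · simp
      · exact (h j hj').le
    have h1 : ‖p.coeff j‖ * δ ^ (j + 1) < ‖x‖ * ‖p.coeff 0‖ := by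
      calc ‖p.coeff j‖ * δ ^ (j + 1) = δ * (‖p.coeff j‖ * δ ^ j) := by ring
        _ ≤ δ * ‖p.coeff 0‖ := by gcongr
        _ < ‖x‖ * ‖p.coeff 0‖ := by gcongr
    have h2 : ‖x * p.coeff (j + 1)‖ * δ ^ (j + 1) < ‖x‖ * ‖p.coeff 0‖ := by
      rw [norm_mul, mul_assoc]
      exact mul_lt_mul_of_pos_left (h (j + 1) j.succ_ne_zero) hx0
    rw [Nat.succ_eq_add_one, sub_mul, coeff_sub, coeff_X_mul, coeff_C_mul]
    have h3 := norm_sub_le_max_norm (p.coeff j) (x * p.coeff (j + 1))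
    refine (mul_le_mul_of_nonneg_right h3 (by positivity)).trans_lt ?_
    rcases max_choice ‖p.coeff j‖ ‖x * p.coeff (j + 1)‖ with h | h <;> rw [h] <;> assumption

/-- The coefficients of a monic polynomial all of whose roots are at most `δ`. -/
theorem norm_coeff_prod_X_sub_C_le_pow {K : Type*} [NormedField K] [IsUltrametricDist K]
    {δ : ℝ} (hδ : 0 ≤ δ) (s : Multiset K) (hs : ∀ x ∈ s, ‖x‖ ≤ δ) {i j : ℕ}
    (hij : i + j = Multiset.card s) : ‖(s.map fun x => X - C x).prod.coeff i‖ ≤ δ ^ j := by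
  induction s using Multiset.induction_on generalizing i j with
  | empty =>
    obtain ⟨rfl, rfl⟩ : i = 0 ∧ j = 0 := by simpa using hij
    simp
  | cons x s ih =>
    have ih' := @ih fun y hy => hs y (Multiset.mem_cons_of_mem hy)
    have hx : ‖x‖ ≤ δ := hs x (Multiset.mem_cons_self _ _)
    rw [Multiset.map_cons, Multiset.prod_cons]
    set p := (s.map fun x => X - C x).prod
    rw [Multiset.card_cons] at hij
    have hx' : ‖x * p.coeff i‖ ≤ δ ^ j := by
      rcases j with - | j
      · have hp : p.natDegree = Multiset.card s := natDegree_multiset_prod_X_sub_C_eq_card s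
        rw [coeff_eq_zero_of_natDegree_lt (by omega)]
        simp
      · rw [norm_mul, pow_succ']
        gcongr
        exact ih' (by omega)
    rw [sub_mul, coeff_sub, coeff_C_mul]
    rcases i with - | i
    · simpa using hx'
    · rw [coeff_X_mul]
      exact (norm_sub_le_max_norm _ _).trans (max_le (ih' (by omega)) hx')

/-- If the roots of `P` are at most `δ` and those of `R` are larger than `δ`, the Newton polygon
of `P * R` has a vertex at `deg P`. -/
theorem norm_coeff_mul_sub_lt {K : Type*} [NormedField K] [IsUltrametricDist K]
    {δ : ℝ} (hδ : 0 ≤ δ) (s t : Multiset K) (hs : ∀ x ∈ s, ‖x‖ ≤ δ) (ht : ∀ x ∈ t, δ < ‖x‖)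
    {c : K} (hc : c ≠ 0) :
    ‖((s.map fun x => X - C x).prod * (C c * (t.map fun x => X - C x).prod)).coeff
        (Multiset.card s) - (C c * (t.map fun x => X - C x).prod).coeff 0‖ <
      ‖(C c * (t.map fun x => X - C x).prod).coeff 0‖ := by
  obtain ⟨h0, h⟩ := norm_coeff_prod_X_sub_C_mul_pow_lt hδ t ht
  set n := Multiset.card s with hn
  set P := (s.map fun x => X - C x).prod with hP
  set R := (t.map fun x => X - C x).prod
  have hPm : P.coeff n = 1 := by
    have hm : P.Monic := monic_multiset_prod_of_monic _ _ fun x _ => monic_X_sub_C x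
    have hd : P.natDegree = n := natDegree_multiset_prod_X_sub_C_eq_card s
    rw [← hd]
    exact hm
  have hmain : ‖(P * R).coeff n - R.coeff 0‖ < ‖R.coeff 0‖ := by
    -- In ∑ P_i R_{n-i} the term i = n is R_0, as P is monic. For i < n, |P_i| ≤ δ^(n-i) and
    -- |R_{n-i}| δ^(n-i) < |R_0|, so the other terms are strictly smaller.
    rw [coeff_mul, Finset.Nat.sum_antidiagonal_eq_sum_range_succ_mk, Finset.sum_range_succ]
    simp only [tsub_self, hPm, one_mul, add_sub_cancel_right]
    rcases Nat.eq_zero_or_pos n with h' | h'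
    · rw [h']; simpa using h0
    · obtain ⟨i, hi, hle⟩ := IsUltrametricDist.exists_norm_finsetSum_le_of_nonempty
        (Finset.nonempty_range_iff.2 h'.ne') fun i => P.coeff i * R.coeff (n - i)
      rw [Finset.mem_range] at hi
      refine hle.trans_lt (lt_of_le_of_lt ?_ (h (n - i) (by omega)))
      rw [norm_mul, mul_comm]
      gcongr
      exact norm_coeff_prod_X_sub_C_le_pow hδ s hs (by omega)
  have h1 : P * (C c * R) = C c * (P * R) := by ring
  rw [h1, coeff_C_mul, coeff_C_mul, ← mul_sub, norm_mul, norm_mul]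
  exact mul_lt_mul_of_pos_left hmain (norm_pos_iff.2 hc)

/-- The derivative of an additive polynomial is constant. -/
theorem GaEnd.eval_derivative {R : Type u} [CommRing R] {S : Type*} [CommRing S] [Algebra R S]
    (p : GaEnd R) (x : S) :
    (derivative (p.poly.map (algebraMap R S))).eval x = algebraMap R S (p.poly.coeff 1) := by
  -- In p(X + x) = p(X) + p(x) the coefficient of X is p'(x) on the left, by Taylor expansion, and
  -- the linear coefficient of p on the right.
  have h := p.aeval_add (S := S[X]) X (C x)
  have h1 := congrArg (fun f => coeff f 1) h
  simp only [coeff_add] at h1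
  have e1 : aeval (X + C x : S[X]) p.poly = taylor x (p.poly.map (algebraMap R S)) := by
    rw [taylor_apply, comp, eval₂_map, aeval_def]
    rfl
  have e2 : aeval (X : S[X]) p.poly = p.poly.map (algebraMap R S) := by
    rw [aeval_def, map]
    rfl
  have e3 : aeval (C x : S[X]) p.poly = C (aeval x p.poly) := by
    exact aeval_algebraMap_apply (A := S) S[X] x p.poly
  rw [e1, taylor_coeff_one, e2, e3] at h1
  simpa using h1

/-- Additive polynomials with nonzero linear coefficient have simple roots. -/
theorem GaEnd.nodup_roots {R : Type u} [CommRing R] {K : Type*} [Field K] [Algebra R K]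
    (p : GaEnd R) (hp : algebraMap R K (p.poly.coeff 1) ≠ 0) :
    (p.poly.map (algebraMap R K)).roots.Nodup := by
  classical
  have h0 : p.poly.map (algebraMap R K) ≠ 0 := fun h => hp (by
    rw [← coeff_map, h, coeff_zero])
  rw [Multiset.nodup_iff_count_le_one]
  intro x
  rw [count_roots]
  by_contra! h
  have := ((one_lt_rootMultiplicity_iff_isRoot h0).1 h).2
  rw [IsRoot, p.eval_derivative] at this
  exact hp this

/-- A nonzero element of minimal degree in an ideal of `O[X]` generates the ideal over any field
containing `O`. -/
theorem exists_mem_ideal_forall_map_dvd {O K : Type*} [CommRing O] [Field K] [Algebra O K]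
    (hinj : Function.Injective (algebraMap O K)) (I : Ideal O[X]) (hI : I ≠ ⊥) :
    ∃ g ∈ I, g ≠ 0 ∧ ∀ f ∈ I, g.map (algebraMap O K) ∣ f.map (algebraMap O K) := by
  classical
  obtain ⟨g₀, hg₀, hg₀0⟩ := Submodule.exists_mem_ne_zero_of_ne_bot hI
  have hex : ∃ n, ∃ g ∈ I, g ≠ 0 ∧ g.natDegree = n := ⟨_, g₀, hg₀, hg₀0, rfl⟩
  obtain ⟨g, hg, hg0, hgn⟩ := Nat.find_spec hex
  have hmin : ∀ f ∈ I, f ≠ 0 → g.natDegree ≤ f.natDegree := fun f hf hf0 => by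
    rw [hgn]
    exact Nat.find_min' hex ⟨f, hf, hf0, rfl⟩
  refine ⟨g, hg, hg0, ?_⟩
  have key : ∀ n, ∀ f ∈ I, f.natDegree < n → g.map (algebraMap O K) ∣ f.map (algebraMap O K) := by
    intro n
    induction n with
    | zero => intro f _ h; omega
    | succ n ih =>
      intro f hf hfn
      rcases eq_or_ne f 0 with rfl | hf0
      · simp
      have hle := hmin f hf hf0
      set a := g.leadingCoeff
      have ha : algebraMap O K a ≠ 0 := by
        rw [Ne, map_eq_zero_iff _ hinj]
        exact leadingCoeff_ne_zero.2 hg0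
      -- Pseudo-division: `a`, the leading coefficient of `g`, need not be invertible in `O`, so `f`
      -- is multiplied by it before the leading terms are cancelled. Over `K` the factor `a` is a
      -- unit and does not affect divisibility.
      set t := C f.leadingCoeff * X ^ (f.natDegree - g.natDegree) * g with ht
      have hf' : C a * f - t ∈ I :=
        I.sub_mem (I.mul_mem_left _ hf) (I.mul_mem_left _ hg)
      have hdvd : g.map (algebraMap O K) ∣ (C a * f - t).map (algebraMap O K) := by
        by_cases hz : C a * f - t = 0
        · rw [hz]; simp
        refine ih _ hf' ?_
        have hlt : (C a * f - t).natDegree < f.natDegree := by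
          have hpos : f.natDegree ≠ 0 := by
            intro h0
            apply hz
            have hg' : g.natDegree = 0 := by omega
            rw [ht, h0, hg']
            have e1 := eq_C_of_natDegree_eq_zero h0
            have e2 := eq_C_of_natDegree_eq_zero hg'
            have e3 : f.leadingCoeff = f.coeff 0 := by rw [leadingCoeff, h0]
            have e4 : a = g.coeff 0 := by simp only [a, leadingCoeff, hg']
            rw [e3, e4]
            rw [Nat.sub_zero, pow_zero, mul_one, e1, e2]
            simp only [coeff_C_zero, ← C_mul, mul_comm, sub_self]
          rw [natDegree_lt_iff_degree_lt hz]
          rw [degree_lt_iff_coeff_zero]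
          intro m hm
          rw [coeff_sub, coeff_C_mul, ht, mul_assoc, coeff_C_mul, mul_comm (X ^ _)]
          rw [coeff_mul_X_pow', if_pos (by omega)]
          rcases hm.eq_or_lt with rfl | hm
          · rw [Nat.sub_sub_self hle, coeff_natDegree, coeff_natDegree]
            ring
          · rw [coeff_eq_zero_of_natDegree_lt hm, coeff_eq_zero_of_natDegree_lt (p := g) (by omega)]
            simp
        omega
      have h1 : C (algebraMap O K a) * f.map (algebraMap O K) =
          (C a * f - t).map (algebraMap O K) + t.map (algebraMap O K) := by simp
      have h2 : g.map (algebraMap O K) ∣ C (algebraMap O K a) * f.map (algebraMap O K) := by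
        rw [h1]
        refine dvd_add hdvd ?_
        rw [ht, Polynomial.map_mul]
        exact dvd_mul_left _ _
      exact ((isUnit_C.2 ha.isUnit).dvd_mul_left).1 h2
  exact fun f hf => key _ f hf (Nat.lt_succ_self _)

end Fields

/-! ### The field `ℂ_℘` -/

section CompletedClosure

variable {Fq : Type u} [Field Fq] [Finite Fq] (ϖ : Fq[X]) [Fact (Irreducible ϖ)]

instance Cwp.isUltrametricDist : IsUltrametricDist (Cwp ϖ) :=
  IsUltrametricDist.of_normedAlgebra (LocalField ϖ)

theorem Cwp.norm_algebraMap (x : LocalField ϖ) : ‖algebraMap (LocalField ϖ) (Cwp ϖ) x‖ = ‖x‖ :=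
  norm_algebraMap' _ _

/-- Needed so that φ_ϖ, its factors, and the generic generator of the ideal of C split into linear
factors over `ℂ_℘`. -/
theorem Cwp.isAlgClosed : IsAlgClosed (Cwp ϖ) := by
  let : NontriviallyNormedField (Cwp ϖ) :=
    { (inferInstance : NormedField (Cwp ϖ)) with
      non_trivial := by
        obtain ⟨x, hx⟩ := NontriviallyNormedField.non_trivial (α := LocalField ϖ)
        exact ⟨algebraMap (LocalField ϖ) (Cwp ϖ) x, by rwa [Cwp.norm_algebraMap]⟩ }
  exact isAlgClosed_of_denseRange_algebraMap (K := AlgClosureLocal ϖ) (L := Cwp ϖ)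
    UniformSpace.Completion.denseRange_coe

theorem norm_polyToCwp_lt_one_iff (a : Fq[X]) : ‖polyToCwp ϖ a‖ < 1 ↔ ϖ ∣ a := by
  rw [← LocalField.norm_algebraMap_lt_one_iff, ← Cwp.norm_algebraMap]
  rfl

theorem polyToCwp_ne_zero {a : Fq[X]} (ha : a ≠ 0) : polyToCwp ϖ a ≠ 0 := by
  have h : polyToCwp ϖ a = algebraMap (LocalField ϖ) (Cwp ϖ)
      (algebraMap (RatFunc Fq) (LocalField ϖ) (algebraMap Fq[X] (RatFunc Fq) a)) := rfl
  rw [h, _root_.map_ne_zero, _root_.map_ne_zero]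
  simpa using ha

theorem Cwp.add_pow_card (n : ℕ) (x y : Cwp ϖ) :
    (x + y) ^ (Nat.card Fq ^ n) = x ^ (Nat.card Fq ^ n) + y ^ (Nat.card Fq ^ n) :=
  add_pow_card_pow ((polyToCwp ϖ).comp C) n x y

theorem Cwp.sub_pow_card (n : ℕ) (x y : Cwp ϖ) :
    (x - y) ^ (Nat.card Fq ^ n) = x ^ (Nat.card Fq ^ n) - y ^ (Nat.card Fq ^ n) := by
  have := Cwp.add_pow_card ϖ n (x - y) y
  rw [sub_add_cancel] at this
  rw [this, add_sub_cancel_right]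

theorem Cwp.natCast_card_eq_zero : (Nat.card Fq : Cwp ϖ) = 0 := by
  let := Fintype.ofFinite Fq
  have h := congrArg ((polyToCwp ϖ).comp C) (FiniteField.cast_card_eq_zero Fq)
  rwa [map_natCast, map_zero, ← Nat.card_eq_fintype_card] at h

theorem one_lt_card_pow : 1 < Nat.card Fq ^ ϖ.natDegree :=
  Nat.one_lt_pow (Fact.out : Irreducible ϖ).natDegree_pos.ne' Finite.one_lt_card

end CompletedClosure

/-! ### Units, 1-units and Teichmüller lifts in the base ring -/

section BaseRing

variable {Fq : Type u} [Field Fq] [Finite Fq] {ϖ : Fq[X]} [Fact (Irreducible ϖ)]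
  {O : Subring (Cwp ϖ)}

theorem IsBaseRing.isUnit_iff (hO : IsBaseRing O) (x : O) : IsUnit x ↔ 1 ≤ ‖(x : Cwp ϖ)‖ := by
  have := hO.isLocalRing
  rw [← not_lt, ← hO.mem_maximalIdeal_iff, IsLocalRing.mem_maximalIdeal, mem_nonunits_iff, not_not]

/-- An element of norm > 1 would lie outside the maximal ideal, hence be a unit; its inverse is
again a unit and so has norm at least 1, which is absurd. -/
theorem IsBaseRing.norm_le_one (hO : IsBaseRing O) (x : O) : ‖(x : Cwp ϖ)‖ ≤ 1 := by
  by_contra! h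
  obtain ⟨y, hy⟩ := ((hO.isUnit_iff x).2 h.le).exists_right_inv
  have h1 : ‖(x : Cwp ϖ)‖ * ‖(y : Cwp ϖ)‖ = 1 := by
    rw [← norm_mul, ← Subring.coe_mul, hy, Subring.coe_one, norm_one]
  have h2 := (hO.isUnit_iff y).1 (IsUnit.of_mul_eq_one x (by rw [mul_comm, hy]))
  nlinarith

theorem IsBaseRing.norm_eq_one (hO : IsBaseRing O) {x : O} (hx : IsUnit x) : ‖(x : Cwp ϖ)‖ = 1 :=
  le_antisymm (hO.norm_le_one x) ((hO.isUnit_iff x).1 hx)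

/-- `Subfield.closure O` plays the role of Frac O inside `ℂ_℘`. -/
theorem IsBaseRing.mem_of_norm_lt_one (hO : IsBaseRing O) {x : Cwp ϖ}
    (hx : x ∈ Subfield.closure (O : Set (Cwp ϖ)))
    (h : ‖x‖ < 1) : x ∈ O := by
  obtain ⟨y, hy, z, hz, rfl⟩ := Subfield.mem_closure_iff.1 hx
  rw [Subring.closure_eq] at hy hz
  rcases eq_or_ne z 0 with rfl | hz0
  · simp
  · rw [norm_div, div_lt_one (norm_pos_iff.2 hz0)] at h
    exact hO.div_mem y hy z hz h

theorem IsBaseRing.mem_of_norm_sub_one_lt (hO : IsBaseRing O) {x : Cwp ϖ}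
    (hx : x ∈ Subfield.closure (O : Set (Cwp ϖ))) (h : ‖x - 1‖ < 1) : x ∈ O := by
  have := O.add_mem (hO.mem_of_norm_lt_one (sub_mem hx (one_mem _)) h) O.one_mem
  rwa [sub_add_cancel] at this

/-- The equation w^(Q-1) = s is, for w ≠ 0, the fixed-point equation w = v w^Q with v = s⁻¹.
Iterating from 1 converges: x ↦ x^Q is additive and |v| = 1, so each step has norm the Q-th power of
the previous one, starting from |v - 1| < 1. Completeness keeps the limit in O. -/
theorem IsBaseRing.exists_pow_eq (hO : IsBaseRing O) {s : Cwp ϖ} (hs : s ∈ O) (hs1 : ‖s - 1‖ < 1) :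
    ∃ w ∈ O, ‖w - 1‖ < 1 ∧ w ^ (Nat.card Fq ^ ϖ.natDegree - 1) = s := by
  have hQ1 := one_lt_card_pow ϖ
  have hsub := fun x y => Cwp.sub_pow_card ϖ ϖ.natDegree x y
  set Q := Nat.card Fq ^ ϖ.natDegree with hQ
  have hv1 := norm_inv_sub_one_lt hs1
  have hvn := norm_eq_one_of_norm_sub_one_lt hv1
  have hs0 : s ≠ 0 := by
    rintro rfl
    simp at hvn
  have hv : s⁻¹ ∈ O := hO.mem_of_norm_sub_one_lt
    (inv_mem (Subfield.subset_closure hs)) hv1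
  set v := s⁻¹
  let u : ℕ → Cwp ϖ := fun n => Nat.rec 1 (fun _ w => v * w ^ Q) n
  have hu : ∀ n, u (n + 1) = v * u n ^ Q := fun n => rfl
  have hstep : ∀ n, ‖u (n + 1) - u n‖ = ‖v - 1‖ ^ Q ^ n := by
    intro n
    induction n with
    | zero => simp [u]
    | succ n ih =>
      rw [hu (n + 1), hu n, ← mul_sub, ← hsub, ← hu, norm_mul, norm_pow, ih, hvn, one_mul,
        pow_succ, pow_mul]
  have hc : CauchySeq u := by
    refine cauchySeq_of_le_geometric ‖v - 1‖ 1 hv1 fun n => ?_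
    rw [dist_comm, dist_eq_norm, hstep, one_mul]
    exact pow_le_pow_of_le_one (norm_nonneg _) hv1.le (Nat.lt_pow_self hQ1).le
  have hmem : ∀ n, u n ∈ O := by
    intro n
    induction n with
    | zero => exact O.one_mem
    | succ n ih => exact O.mul_mem hv (O.pow_mem ih _)
  obtain ⟨w, hwO, hw⟩ := cauchySeq_tendsto_of_isComplete hO.isComplete hmem hc
  have hdist : ∀ n, ‖u n - 1‖ ≤ ‖v - 1‖ := by
    intro n
    induction n with
    | zero => simp [u]
    | succ n ih =>
      rw [← sub_add_sub_cancel (u (n + 1)) (u n) 1]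
      refine (IsUltrametricDist.norm_add_le_max _ _).trans (max_le ?_ ih)
      rw [hstep]
      exact pow_le_of_le_one (norm_nonneg _) hv1.le (pow_ne_zero _ (by omega))
  have hw1 : ‖w - 1‖ < 1 :=
    (le_of_tendsto (hw.sub_const 1).norm (Filter.Eventually.of_forall hdist)).trans_lt hv1
  have h1 : Filter.Tendsto (fun n => u (n + 1)) Filter.atTop (nhds (v * w ^ Q)) := by
    simp_rw [hu]; exact (hw.pow Q).const_mul v
  have h2 : Filter.Tendsto (fun n => u (n + 1)) Filter.atTop (nhds w) :=
    (Filter.tendsto_add_atTop_iff_nat 1).2 hw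
  have h3 : v * w ^ Q = w := tendsto_nhds_unique h1 h2
  refine ⟨w, hwO, hw1, ?_⟩
  have hw0 : w ≠ 0 := by
    rintro rfl
    simp at hw1
  refine mul_right_cancel₀ hw0 ?_
  rw [← pow_succ, Nat.sub_add_cancel hQ1.le]
  nth_rw 2 [← h3]
  rw [mul_inv_cancel_left₀ hs0]

theorem IsBaseRing.norm_residueLift_sub_lt (hO : IsBaseRing O) (a : Fq[X]) :
    ‖(hO.residueLift a : Cwp ϖ) - polyToCwp ϖ a‖ < 1 := by
  have h : residueMap ϖ (polyToCoeffSubfield ϖ a) =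
      IsLocalRing.residue (LocalIntegers ϖ) (algebraMap Fq[X] (LocalIntegers ϖ) a) :=
    (iota ϖ).apply_symm_apply _
  have h' := (residue_eq_iff ϖ _ _).1 h
  rw [← Cwp.norm_algebraMap, map_sub] at h'
  exact h'

theorem IsBaseRing.residueLift_pow (hO : IsBaseRing O) (a : Fq[X]) :
    hO.residueLift a ^ (Nat.card Fq ^ ϖ.natDegree) = hO.residueLift a := by
  rw [IsBaseRing.residueLift, RingHom.comp_apply, ← map_pow, RingHom.comp_apply]
  exact congrArg _ (polyToCoeffSubfield ϖ a).2

/-- The lift has norm < 1 and is fixed by x ↦ x^Q, which strictly shrinks nonzero elements of norm <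
1. -/
theorem IsBaseRing.residueLift_self (hO : IsBaseRing O) : hO.residueLift ϖ = 0 := by
  have h1 := hO.norm_residueLift_sub_lt ϖ
  have h2 := (norm_polyToCwp_lt_one_iff ϖ ϖ).2 dvd_rfl
  have h3 : ‖(hO.residueLift ϖ : Cwp ϖ)‖ < 1 := by
    rw [← sub_add_cancel (hO.residueLift ϖ : Cwp ϖ) (polyToCwp ϖ ϖ)]
    exact (IsUltrametricDist.norm_add_le_max _ _).trans_lt (max_lt h1 h2)
  by_contra h0
  have h4 := congrArg (fun z : O => ‖(z : Cwp ϖ)‖) (hO.residueLift_pow ϖ)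
  simp only [Subring.coe_pow, norm_pow] at h4
  exact (pow_lt_self_of_lt_one₀ (norm_pos_iff.2 fun h => h0 (Subtype.ext h)) h3
    (one_lt_card_pow ϖ)).ne h4

end BaseRing

/-! ### Flat closed subschemes of the affine line -/

section FlatIdeal

variable {Fq : Type u} [Field Fq] [Finite Fq] {ϖ : Fq[X]} [Fact (Irreducible ϖ)]
  {O : Subring (Cwp ϖ)}

/-- A flat closed subscheme of the affine line over `O` that is contained in an étale one and whose
geometric points lie in the open unit disc is cut out by a monic polynomial. -/
theorem IsBaseRing.exists_monic_span_eq (hO : IsBaseRing O) (I : Ideal O[X])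
    (hflat : Module.Flat O (O[X] ⧸ I)) (p : O[X]) (hpI : p ∈ I) (hp0 : p ≠ 0)
    (hp : (p.map (algebraMap O (Cwp ϖ))).roots.Nodup) (N : Finset (Cwp ϖ))
    (hN : ∀ x, x ∈ N ↔ ∀ f ∈ I, aeval x f = 0) (hN1 : ∀ x ∈ N, ‖x‖ < 1) :
    ∃ P : O[X], P.Monic ∧ P.map (algebraMap O (Cwp ϖ)) = ∏ x ∈ N, (X - C x) ∧
      I = Ideal.span {P} ∧ ∀ f, f ∈ I ↔ ∀ x ∈ N, aeval x f = 0 := by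
  classical
  have := Cwp.isAlgClosed ϖ
  have hinj : Function.Injective (algebraMap O (Cwp ϖ)) := Subtype.val_injective
  have hmapinj := map_injective (algebraMap O (Cwp ϖ)) hinj
  obtain ⟨g, hgI, hg0, hg⟩ := exists_mem_ideal_forall_map_dvd hinj I
    fun h => hp0 (by simpa [h] using hpI)
  have hg0' : g.map (algebraMap O (Cwp ϖ)) ≠ 0 := fun h => hg0 (hmapinj (by rw [h]; simp))
  have hp0' : p.map (algebraMap O (Cwp ϖ)) ≠ 0 := fun h => hp0 (hmapinj (by rw [h]; simp))
  have hnodup : (g.map (algebraMap O (Cwp ϖ))).roots.Nodup :=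
    Multiset.nodup_of_le (roots.le_of_dvd hp0' (hg p hpI)) hp
  have hroots : (g.map (algebraMap O (Cwp ϖ))).roots = N.val := by
    rw [Multiset.Nodup.ext hnodup N.nodup]
    intro x
    rw [Finset.mem_val, hN, mem_roots hg0', IsRoot, eval_map_algebraMap]
    refine ⟨fun h f hf => ?_, fun h => h g hgI⟩
    obtain ⟨q, hq⟩ := hg f hf
    rw [← eval_map_algebraMap, hq, eval_mul, eval_map_algebraMap, h, zero_mul]
  set a : Cwp ϖ := algebraMap O (Cwp ϖ) g.leadingCoeff with ha
  have ha0 : a ≠ 0 := by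
    rw [ha, Ne, map_eq_zero_iff _ hinj]
    exact leadingCoeff_ne_zero.2 hg0
  have hgmap : g.map (algebraMap O (Cwp ϖ)) = C a * ∏ x ∈ N, (X - C x) := by
    have h := (IsAlgClosed.splits (g.map (algebraMap O (Cwp ϖ)))).eq_prod_roots
    rw [hroots, leadingCoeff_map_of_injective hinj] at h
    exact h
  set P₀ : (Cwp ϖ)[X] := ∏ x ∈ N, (X - C x) with hP₀
  have hP₀m : P₀.Monic := monic_prod_of_monic _ _ fun x _ => monic_X_sub_C x
  have hP₀deg : P₀.natDegree = N.card := natDegree_finsetProd_X_sub_C_eq_card N _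
  -- The coefficients of `P₀` are quotients of coefficients of `g`, hence lie in Frac O. Below the
  -- top degree they have norm < 1 because all the roots do, and such elements of Frac O belong to
  -- O.
  have hcoeff : ∀ i, P₀.coeff i ∈ O := by
    intro i
    rcases lt_trichotomy i N.card with hi | rfl | hi
    · refine hO.mem_of_norm_lt_one ?_ ?_
      · have h : P₀.coeff i = (g.coeff i : Cwp ϖ) / (g.leadingCoeff : Cwp ϖ) := by
          refine (eq_div_iff ha0).2 ?_
          have h1 := congrArg (fun f => coeff f i) hgmap
          simp only [coeff_C_mul, coeff_map] at h1
          rw [mul_comm]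
          exact h1.symm
        rw [h]
        exact _root_.div_mem (Subfield.subset_closure (g.coeff i).2)
          (Subfield.subset_closure (g.leadingCoeff).2)
      · obtain ⟨δ, hδ0, hδ1, hδ⟩ : ∃ δ : ℝ, 0 ≤ δ ∧ δ < 1 ∧ ∀ x ∈ N, ‖x‖ ≤ δ := by
          have hne : N.Nonempty := Finset.card_pos.1 (by omega)
          obtain ⟨y, hy, hmax⟩ := N.exists_max_image (fun x => ‖x‖) hne
          exact ⟨‖y‖, norm_nonneg _, hN1 y hy, hmax⟩
        refine (norm_coeff_prod_X_sub_C_le_pow hδ0 N.val (fun x hx => hδ x hx)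
          (i := i) (j := N.card - i) ?_).trans_lt (pow_lt_one₀ hδ0 hδ1 (by omega))
        rw [Finset.card_val]
        omega
    · have : P₀.coeff N.card = 1 := by rw [← hP₀deg]; exact hP₀m
      rw [this]
      exact O.one_mem
    · rw [coeff_eq_zero_of_natDegree_lt (by omega)]
      exact O.zero_mem
  obtain ⟨P, hP, hPdeg, hPm⟩ := lifts_and_natDegree_eq_and_monic
    (show P₀ ∈ lifts (algebraMap O (Cwp ϖ)) from
      (lifts_iff_coeff_lifts _).2 fun i => ⟨⟨P₀.coeff i, hcoeff i⟩, rfl⟩) hP₀m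
  have hgP : C g.leadingCoeff * P = g := by
    apply hmapinj
    rw [Polynomial.map_mul, map_C, hP, hgmap]
  -- Flatness enters here: `O[X] ⧸ I` is torsion-free, and a nonzero constant times `P` is `g`,
  -- which lies in `I`.
  have hPI : P ∈ I := by
    rw [← Ideal.Quotient.eq_zero_iff_mem]
    have h : g.leadingCoeff • (Ideal.Quotient.mk I P) = g.leadingCoeff • 0 := by
      rw [smul_zero]
      have h1 : Ideal.Quotient.mk I (g.leadingCoeff • P) = 0 := by
        rwa [smul_eq_C_mul, hgP, Ideal.Quotient.eq_zero_iff_mem]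
      exact h1
    exact Module.IsTorsionFree.isSMulRegular
      (IsRegular.of_ne_zero (leadingCoeff_ne_zero.2 hg0)) h
  have hdvd : ∀ f : O[X], (∀ x ∈ N, aeval x f = 0) → P ∣ f := by
    intro f hf
    rw [← map_dvd_map _ hinj hPm, hP]
    refine Finset.prod_dvd_of_coprime (fun x _ y _ hxy => ?_) fun x hx => ?_
    · exact isCoprime_X_sub_C_of_isUnit_sub (sub_ne_zero.2 hxy).isUnit
    · rw [dvd_iff_isRoot, IsRoot, eval_map_algebraMap]
      exact hf x hx
  refine ⟨P, hPm, hP, le_antisymm (fun f hf => ?_) ?_, fun f => ⟨fun hf x hx => ?_, fun hf => ?_⟩⟩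
  · exact Ideal.mem_span_singleton.2 (hdvd f fun x hx => (hN x).1 hx f hf)
  · rwa [Ideal.span_singleton_le_iff_mem]
  · exact (hN x).1 hx f hf
  · obtain ⟨q, rfl⟩ := hdvd f hf
    exact I.mul_mem_right _ hPI

end FlatIdeal

/-! ### Surjectivity by Nakayama's lemma, and the criterion for an isomorphism -/

section Generation

/-- Over a local ring, a polynomial with zero constant term and invertible linear coefficient
generates every quotient of `R[X]` by an ideal containing a distinguished polynomial. -/
theorem exists_sub_comp_mem {R : Type*} [CommRing R] [IsLocalRing R] (I : Ideal R[X]) {P : R[X]}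
    (hP : P.Monic) (hPI : P ∈ I)
    (hPc : ∀ i < P.natDegree, P.coeff i ∈ IsLocalRing.maximalIdeal R)
    {F : R[X]} (h0 : F.coeff 0 = 0) (h1 : IsUnit (F.coeff 1)) (g : R[X]) :
    ∃ h : R[X], g - h.comp F ∈ I := by
  let π : R[X] →ₗ[R] R[X] ⧸ I := (Ideal.Quotient.mkₐ R I).toLinearMap
  have hπ : ∀ f, π f = 0 ↔ f ∈ I := fun f => Ideal.Quotient.eq_zero_iff_mem
  have hπs : Function.Surjective π := Ideal.Quotient.mk_surjective
  have hfin : Module.Finite R (R[X] ⧸ I) := by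
    have := hP.finite_quotient
    exact Module.Finite.of_surjective
      (Ideal.Quotient.factorₐ R ((Ideal.span_singleton_le_iff_mem I).2 hPI)).toLinearMap
      (Ideal.Quotient.factor_surjective ((Ideal.span_singleton_le_iff_mem I).2 hPI))
  let N : Submodule R (R[X] ⧸ I) := LinearMap.range (π ∘ₗ (aeval F : R[X] →ₐ[R] R[X]).toLinearMap)
  let V : Submodule R (R[X] ⧸ I) :=
    N ⊔ IsLocalRing.maximalIdeal R • (⊤ : Submodule R (R[X] ⧸ I))
  have hsum : ∀ f : R[X], (∀ i, f.coeff i • π (X ^ i) ∈ V) → π f ∈ V := by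
    intro f hf
    rw [f.as_sum_range_C_mul_X_pow, map_sum]
    refine Submodule.sum_mem _ fun i _ => ?_
    rw [← smul_eq_C_mul, map_smul]
    exact hf i
  have hNV : ∀ f : R[X], π (f.comp F) ∈ V := fun f =>
    Submodule.mem_sup_left ⟨f, rfl⟩
  obtain ⟨H, hH⟩ : ∃ H : R[X], F = X * (C (F.coeff 1) + X * H) := by
    refine ⟨F.divX.divX, ?_⟩
    have e1 := F.X_mul_divX_add
    have e2 := F.divX.X_mul_divX_add
    rw [h0, C_0, add_zero] at e1
    rw [coeff_divX, add_comm] at e2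
    rw [e2, e1]
  -- Descending induction on `n`, with `k` bounding the distance to `deg P`. From `deg P` on,
  -- reduction by `P` leaves coefficients in the maximal ideal. Below, F^n is a unit times X^n plus
  -- a multiple of X^(n+1), whose terms are already in `V`.
  have hX : ∀ k n, P.natDegree ≤ n + k → π (X ^ n) ∈ V := by
    intro k
    induction k with
    | zero =>
      intro n hn
      obtain ⟨m, rfl⟩ := Nat.exists_eq_add_of_le' (show P.natDegree ≤ n from hn)
      have h : π (X ^ (m + P.natDegree)) = π (X ^ m * (X ^ P.natDegree - P)) := by
        rw [← sub_eq_zero, ← map_sub, hπ, mul_sub, ← pow_add, sub_sub_cancel]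
        exact I.mul_mem_left _ hPI
      rw [h]
      refine hsum _ fun i => Submodule.mem_sup_right (Submodule.smul_mem_smul ?_ trivial)
      rw [coeff_X_pow_mul']
      split_ifs with hi
      · rw [coeff_sub, coeff_X_pow]
        rcases lt_trichotomy (i - m) P.natDegree with h | h | h
        · rw [if_neg h.ne, zero_sub]
          exact neg_mem (hPc _ h)
        · rw [if_pos h, h, hP.coeff_natDegree, sub_self]
          exact zero_mem _
        · rw [if_neg h.ne', coeff_eq_zero_of_natDegree_lt h, sub_self]
          exact zero_mem _
      · exact zero_mem _
    | succ k ih =>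
      intro n hn
      obtain ⟨H', hH'⟩ : ∃ H' : R[X], F ^ n = C (F.coeff 1 ^ n) * X ^ n + X ^ (n + 1) * H' := by
        obtain ⟨q, hq⟩ := sub_dvd_pow_sub_pow (C (F.coeff 1) + X * H) (C (F.coeff 1)) n
        refine ⟨H * q, ?_⟩
        rw [add_sub_cancel_left, sub_eq_iff_eq_add] at hq
        nth_rw 1 [hH]
        rw [mul_pow, hq, C_pow]
        ring
      have hmem : F.coeff 1 ^ n • π (X ^ n) ∈ V := by
        have h : F.coeff 1 ^ n • π (X ^ n) = π ((X ^ n : R[X]).comp F) - π (X ^ (n + 1) * H') := by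
          rw [← map_smul, smul_eq_C_mul, ← map_sub, X_pow_comp, hH', add_sub_cancel_right]
        rw [h]
        refine sub_mem (hNV _) (hsum _ fun i => ?_)
        rw [coeff_X_pow_mul']
        split_ifs with hi
        · exact V.smul_mem _ (ih i (by omega))
        · rw [zero_smul]
          exact zero_mem _
      obtain ⟨v, hv⟩ := (h1.pow n).exists_left_inv
      have := V.smul_mem v hmem
      rwa [smul_smul, hv, one_smul] at this
  have htop : (⊤ : Submodule R (R[X] ⧸ I)) ≤ N := by
    refine Submodule.le_of_le_smul_of_le_jacobson_bot Module.Finite.fg_top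
      (IsLocalRing.maximalIdeal_le_jacobson _) fun y _ => ?_
    obtain ⟨f, rfl⟩ := hπs y
    exact hsum f fun i => V.smul_mem _ (hX _ i (Nat.le_add_left _ _))
  obtain ⟨h, hh⟩ := htop (show π g ∈ ⊤ from trivial)
  refine ⟨h, (hπ _).1 ?_⟩
  rw [map_sub, sub_eq_zero]
  exact hh.symm

namespace ModuleScheme

variable {A O : Type u} [CommRing A] [CommRing O]

/-- The ideal of `O[X]` defining a closed submodule scheme of the additive group. -/
def ClosedSubmodule.gaIdeal {ρ : A →+* GaEnd O} (H : ClosedSubmodule (ga ρ)) : Ideal O[X] :=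
  H.ideal

theorem coord_comp_mkₐ {ρ : A →+* GaEnd O} (H : ClosedSubmodule (ga ρ)) {R : Type u} [CommRing R]
    [Algebra O R] (x : H.toModuleScheme.Points R) (f : O[X]) :
    (show O[X] ⧸ H.gaIdeal →ₐ[O] R from x) (Ideal.Quotient.mk _ f) =
      aeval (coord (ρ := ρ) (H.pointsEquiv R x : (ga ρ).Points R)) f :=
  apply_eq_aeval_coord ρ (H.pointsEquiv R x : (ga ρ).Points R) f

/-- A closed submodule scheme of `(𝔾_a, ρ)` is isomorphic to the kernel of `p` in `(𝔾_a, σ)` as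
soon as an additive polynomial `F` that is equivariant modulo the ideal induces an isomorphism of
coordinate rings. -/
theorem nonempty_iso_gaKernel {ρ σ : A →+* GaEnd O} (H : ClosedSubmodule (ga ρ)) (p : GaEnd O)
    (hp : ∀ a, p * σ a = σ a * p) (F : GaEnd O)
    (hmem : ∀ g : O[X], g.comp F.poly ∈ H.gaIdeal ↔ g ∈ Ideal.span {p.poly})
    (hsurj : ∀ g : O[X], ∃ h : O[X], g - h.comp F.poly ∈ H.gaIdeal)
    (hequiv : ∀ a, (F * ρ a).poly - (σ a * F).poly ∈ H.gaIdeal) :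
    Nonempty (Iso H.toModuleScheme (gaKernel σ p hp).toModuleScheme) := by
  let I : Ideal O[X] := H.gaIdeal
  let J : Ideal O[X] := Ideal.span {p.poly}
  let θ : O[X] →ₐ[O] O[X] ⧸ I := (Ideal.Quotient.mkₐ O I).comp (aeval F.poly)
  have hθ : ∀ g, θ g = Ideal.Quotient.mk I (g.comp F.poly) := fun g => rfl
  have hθJ : ∀ g, g ∈ J → θ g = 0 := fun g hg =>
    (Ideal.Quotient.eq_zero_iff_mem).2 ((hmem g).2 hg)
  let e₀ : (O[X] ⧸ J) →ₐ[O] (O[X] ⧸ I) := Ideal.Quotient.liftₐ J θ hθJ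
  have he₀ : ∀ g, e₀ (Ideal.Quotient.mk J g) = Ideal.Quotient.mk I (g.comp F.poly) := fun g => rfl
  have hbij : Function.Bijective e₀ := by
    constructor
    · rw [injective_iff_map_eq_zero]
      intro y hy
      obtain ⟨g, rfl⟩ := Ideal.Quotient.mk_surjective y
      rw [he₀, Ideal.Quotient.eq_zero_iff_mem] at hy
      exact Ideal.Quotient.eq_zero_iff_mem.2 ((hmem g).1 hy)
    · intro y
      obtain ⟨g, rfl⟩ := Ideal.Quotient.mk_surjective y
      obtain ⟨h, hh⟩ := hsurj g
      refine ⟨Ideal.Quotient.mk J h, ?_⟩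
      rw [he₀]
      exact (Ideal.Quotient.eq.2 hh).symm
  let e : (gaKernel σ p hp).toModuleScheme.coordRing ≃ₐ[O] H.toModuleScheme.coordRing :=
    AlgEquiv.ofBijective e₀ hbij
  have hcoord : ∀ (R : Type u) [CommRing R] [Algebra O R] (x : H.toModuleScheme.Points R),
      coord (ρ := σ) ((gaKernel σ p hp).pointsEquiv R (x.comp e.toAlgHom) : (ga σ).Points R) =
        aeval (coord (ρ := ρ) (H.pointsEquiv R x : (ga ρ).Points R)) F.poly := by
    intro R _ _ x
    have h := coord_comp_mkₐ H x ((X : O[X]).comp F.poly)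
    rw [X_comp] at h
    rw [← h]
    rw [← X_comp (p := F.poly)]
    rfl
  have hinj : ∀ (R : Type u) [CommRing R] [Algebra O R]
      (x y : (gaKernel σ p hp).toModuleScheme.Points R),
      coord (ρ := σ) ((gaKernel σ p hp).pointsEquiv R x : (ga σ).Points R) =
        coord (ρ := σ) ((gaKernel σ p hp).pointsEquiv R y : (ga σ).Points R) → x = y := by
    intro R _ _ x y h
    exact ((gaKernel σ p hp).pointsEquiv R).injective
      (Subtype.ext ((gaPointsEquiv R).injective h))
  refine ⟨⟨e, ?_, ?_⟩⟩
  · intro R _ _ x y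
    apply hinj
    refine (hcoord R (x + y)).trans ?_
    have h1 : (H.pointsEquiv R (x + y) : (ga ρ).Points R) =
        (H.pointsEquiv R x : (ga ρ).Points R) + (H.pointsEquiv R y : (ga ρ).Points R) :=
      congrArg Subtype.val (H.pointsEquiv_add R x y)
    have h2 := congrArg Subtype.val ((gaKernel σ p hp).pointsEquiv_add R
      (x.comp e.toAlgHom) (y.comp e.toAlgHom))
    rw [h1, coord_add, F.aeval_add, ← hcoord R x, ← hcoord R y, ← coord_add]
    exact (congrArg coord h2).symm
  · intro R _ _ a x
    apply hinj
    refine (hcoord R (a • x)).trans ?_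
    have h1 : (H.pointsEquiv R (a • x) : (ga ρ).Points R) =
        a • (H.pointsEquiv R x : (ga ρ).Points R) :=
      congrArg Subtype.val (H.pointsEquiv_smul R a x)
    have h2 := congrArg Subtype.val ((gaKernel σ p hp).pointsEquiv_smul R a (x.comp e.toAlgHom))
    -- Equivariance modulo the ideal suffices, because every point of `H` kills that ideal.
    have h3 : aeval (coord (ρ := ρ) (H.pointsEquiv R x : (ga ρ).Points R))
        ((F * ρ a).poly - (σ a * F).poly) = 0 :=
      (apply_eq_aeval_coord ρ _ _).symm.trans
        ((H.mem_points R _).1 (H.pointsEquiv R x).2 _ (hequiv a))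
    rw [map_sub, GaEnd.poly_mul, GaEnd.poly_mul, aeval_comp, aeval_comp, sub_eq_zero] at h3
    rw [h1, coord_smul, h3, ← hcoord R x, ← coord_smul]
    exact (congrArg coord h2).symm

end ModuleScheme

end Generation

/-! ### Teichmüller lifts of `A / ℘` and the eigenprojector -/

section Eigen

theorem prod_eq_mul_prod_units {k M : Type*} [Field k] [Fintype k] [Fintype kˣ] [CommMonoid M]
    (f : k → M) : ∏ c, f c = f 0 * ∏ b : kˣ, f b := by
  classical
  rw [Fintype.prod_eq_mul_prod_subtype_ne f 0]
  congr 1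
  exact (Fintype.prod_equiv unitsEquivNeZero (fun b : kˣ => f b) (fun i => f i) fun b => rfl).symm

namespace GaEnd

variable {R : Type u} [CommRing R]

/-- The polynomial underlying an endomorphism of the additive group, as an additive map. -/
def polyHom : GaEnd R →+ R[X] where
  toFun := poly
  map_zero' := rfl
  map_add' _ _ := rfl

theorem poly_sum {ι : Type*} (s : Finset ι) (f : ι → GaEnd R) :
    (∑ i ∈ s, f i).poly = ∑ i ∈ s, (f i).poly :=
  map_sum polyHom f s

theorem poly_scalar_mul (a : R) (p : GaEnd R) : (scalar a * p).poly = C a * p.poly := by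
  rw [poly_mul]
  change (C a * X).comp p.poly = _
  simp

theorem coeff_zero (p : GaEnd R) : p.poly.coeff 0 = 0 := by
  simpa [coeff_zero_eq_aeval_zero] using p.aeval_zero (S := R)

end GaEnd

variable {Fq : Type u} [Field Fq] [Finite Fq] {ϖ : Fq[X]} [Fact (Irreducible ϖ)]
  {O : Subring (Cwp ϖ)}

/-- The field `A / ℘`. -/
abbrev ResidueRing (ϖ : Fq[X]) : Type u := Fq[X] ⧸ (Ideal.span {ϖ} : Ideal Fq[X])

instance ResidueRing.isMaximal : (Ideal.span {ϖ} : Ideal Fq[X]).IsMaximal :=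
  PrincipalIdealRing.isMaximal_of_irreducible Fact.out

instance ResidueRing.field : Field (ResidueRing ϖ) := Ideal.Quotient.field _

instance ResidueRing.finite : Finite (ResidueRing ϖ) := by
  have h0 : ϖ ≠ 0 := (Fact.out : Irreducible ϖ).ne_zero
  have : Module.Finite Fq (AdjoinRoot ϖ) := (AdjoinRoot.powerBasis h0).finite
  exact Module.finite_of_finite Fq (M := AdjoinRoot ϖ)

instance ResidueRing.fintype : Fintype (ResidueRing ϖ) := Fintype.ofFinite _

instance ResidueRing.fintypeUnits : Fintype (ResidueRing ϖ)ˣ := Fintype.ofFinite _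

theorem ResidueRing.card_eq : Fintype.card (ResidueRing ϖ) = Nat.card Fq ^ ϖ.natDegree := by
  have h0 : ϖ ≠ 0 := (Fact.out : Irreducible ϖ).ne_zero
  have : Module.Finite Fq (AdjoinRoot ϖ) := (AdjoinRoot.powerBasis h0).finite
  rw [← Nat.card_eq_fintype_card, ← AdjoinRoot.powerBasis_dim h0,
    ← (AdjoinRoot.powerBasis h0).finrank]
  exact Module.natCard_eq_pow_finrank (K := Fq) (V := AdjoinRoot ϖ)

theorem ResidueRing.card_units :
    Fintype.card (ResidueRing ϖ)ˣ = Nat.card Fq ^ ϖ.natDegree - 1 := by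
  classical
  rw [← ResidueRing.card_eq, ← Nat.card_eq_fintype_card, ← Nat.card_eq_fintype_card]
  exact Nat.card_units _

/-- The Teichmüller embedding `A / ℘ → O`. -/
def IsBaseRing.teichmuller (hO : IsBaseRing O) : ResidueRing ϖ →+* O :=
  Ideal.Quotient.lift _ hO.residueLift fun a ha => by
    obtain ⟨b, rfl⟩ := Ideal.mem_span_singleton'.1 ha
    rw [map_mul, hO.residueLift_self, mul_zero]

theorem IsBaseRing.teichmuller_mk (hO : IsBaseRing O) (a : Fq[X]) :
    hO.teichmuller (Ideal.Quotient.mk _ a) = hO.residueLift a := rfl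

theorem IsBaseRing.teichmuller_pow (hO : IsBaseRing O) (c : ResidueRing ϖ) :
    hO.teichmuller c ^ (Nat.card Fq ^ ϖ.natDegree) = hO.teichmuller c := by
  obtain ⟨a, rfl⟩ := Ideal.Quotient.mk_surjective c
  rw [hO.teichmuller_mk, hO.residueLift_pow]

theorem IsBaseRing.norm_aeval_le_one (hO : IsBaseRing O) (f : O[X]) {x : Cwp ϖ} (hx : ‖x‖ ≤ 1) :
    ‖aeval x f‖ ≤ 1 := by
  rw [aeval_eq_sum_range]
  refine IsUltrametricDist.norm_sum_le_of_forall_le_of_nonneg zero_le_one fun i _ => ?_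
  rw [Algebra.smul_def, norm_mul, norm_pow]
  exact mul_le_one₀ (hO.norm_le_one _) (by positivity) (pow_le_one₀ (norm_nonneg _) hx)

/-- A polynomial congruent to `X` modulo terms of degree at least two and the maximal ideal moves
points of the open disc only slightly. -/
theorem IsBaseRing.norm_aeval_div_sub_one_lt (hO : IsBaseRing O) {f : O[X]}
    (h0 : f.coeff 0 = 0) (h1 : ‖(f.coeff 1 : Cwp ϖ) - 1‖ < 1) {x : Cwp ϖ} (hx0 : x ≠ 0)
    (hx : ‖x‖ < 1) : ‖aeval x f / x - 1‖ < 1 := by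
  have e1 := f.X_mul_divX_add
  have e2 := f.divX.X_mul_divX_add
  rw [h0, C_0, add_zero] at e1
  rw [coeff_divX] at e2
  have h : aeval x f / x - 1 = x * aeval x f.divX.divX + ((f.coeff 1 : Cwp ϖ) - 1) := by
    rw [← e1, ← e2, map_mul, aeval_X, mul_div_cancel_left₀ _ hx0, map_add, map_mul, aeval_X,
      aeval_C, e2, e1, add_sub_assoc]
    rfl
  rw [h]
  refine (IsUltrametricDist.norm_add_le_max _ _).trans_lt (max_lt ?_ h1)
  rw [norm_mul]
  exact mul_lt_one_of_nonneg_of_lt_one_left (norm_nonneg _) hx (hO.norm_aeval_le_one _ hx.le)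

namespace DrinfeldModule

variable {r : ℕ} (φ : DrinfeldModule O r)

/-- The additive polynomial `-∑ b⁻¹ φ_b`, the sum over representatives of the nonzero classes of
`A / ℘`: the projector to the part of `φ[ϖ]` on which `A` acts through the Teichmüller
embedding. -/
def eigenProjector (hO : IsBaseRing O) : GaEnd O :=
  -∑ b : (ResidueRing ϖ)ˣ,
    GaEnd.scalar (hO.teichmuller ↑b⁻¹) * φ.toRingHom (Quotient.out (b : ResidueRing ϖ))

/-- The linear coefficient of φ_b is b itself, congruent to its Teichmüller lift. Each of the Q - 1
summands is therefore congruent to 1, and -(Q - 1) = 1 in characteristic p. -/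
theorem norm_coeff_one_eigenProjector_sub_one_lt (hO : IsBaseRing O) :
    ‖((φ.eigenProjector hO).poly.coeff 1 : Cwp ϖ) - 1‖ < 1 := by
  have h1 : ((φ.eigenProjector hO).poly.coeff 1 : Cwp ϖ) = -∑ b : (ResidueRing ϖ)ˣ,
      (hO.teichmuller ↑b⁻¹ : Cwp ϖ) * polyToCwp ϖ (Quotient.out (b : ResidueRing ϖ)) := by
    rw [eigenProjector, GaEnd.poly_neg, GaEnd.poly_sum, coeff_neg, finsetSum_coeff,
      Subring.coe_neg, AddSubmonoidClass.coe_finsetSum]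
    congr 1
    refine Finset.sum_congr rfl fun b _ => ?_
    rw [GaEnd.poly_scalar_mul, coeff_C_mul, Subring.coe_mul, φ.coeff_one]
  have h2 : ∑ b : (ResidueRing ϖ)ˣ,
      (hO.teichmuller ↑b⁻¹ : Cwp ϖ) * (hO.teichmuller ↑b : Cwp ϖ) = -1 := by
    have h : ∀ b : (ResidueRing ϖ)ˣ,
        (hO.teichmuller ↑b⁻¹ : Cwp ϖ) * (hO.teichmuller ↑b : Cwp ϖ) = 1 := fun b => by
      rw [← Subring.coe_mul, ← map_mul, Units.inv_mul, map_one, Subring.coe_one]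
    rw [Finset.sum_congr rfl fun b _ => h b, Finset.sum_const, Finset.card_univ,
      ResidueRing.card_units, nsmul_eq_mul, mul_one, Nat.cast_sub (one_lt_card_pow ϖ).le,
      Nat.cast_pow, Cwp.natCast_card_eq_zero, zero_pow
        (Fact.out : Irreducible ϖ).natDegree_pos.ne', Nat.cast_one, zero_sub]
  have h3 : ((φ.eigenProjector hO).poly.coeff 1 : Cwp ϖ) - 1 = ∑ b : (ResidueRing ϖ)ˣ,
      (hO.teichmuller ↑b⁻¹ : Cwp ϖ) * ((hO.teichmuller ↑b : Cwp ϖ) -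
        polyToCwp ϖ (Quotient.out (b : ResidueRing ϖ))) := by
    simp only [mul_sub, Finset.sum_sub_distrib]
    rw [h1, h2]
    ring
  rw [h3]
  obtain ⟨b, -, hb⟩ := IsUltrametricDist.exists_norm_finsetSum_le_of_nonempty
    (Finset.univ_nonempty (α := (ResidueRing ϖ)ˣ)) fun b : (ResidueRing ϖ)ˣ =>
      (hO.teichmuller ↑b⁻¹ : Cwp ϖ) * ((hO.teichmuller ↑b : Cwp ϖ) -
        polyToCwp ϖ (Quotient.out (b : ResidueRing ϖ)))
  refine hb.trans_lt ?_
  rw [norm_mul]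
  refine mul_lt_one_of_nonneg_of_lt_one_right (hO.norm_le_one _) (norm_nonneg _) ?_
  have h4 : hO.teichmuller (b : ResidueRing ϖ) =
      hO.residueLift (Quotient.out (b : ResidueRing ϖ)) := by
    rw [← hO.teichmuller_mk]
    exact congrArg _ (Ideal.Quotient.mk_out _).symm
  rw [h4]
  exact hO.norm_residueLift_sub_lt _

/-- For c ≠ 0, replacing b by bc in the sum for f(m_1) turns b̃⁻¹ m_b into c̃⁻¹ b̃⁻¹ m_{bc}, by
multiplicativity of the lift. -/
theorem aeval_eigenProjector (hO : IsBaseRing O) {m : ResidueRing ϖ → Cwp ϖ} (hm0 : m 0 = 0)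
    (hm : ∀ a c, aeval (m c) (φ.toRingHom a).poly = m (Ideal.Quotient.mk _ a * c))
    (c : ResidueRing ϖ) :
    aeval (m c) (φ.eigenProjector hO).poly =
      (hO.teichmuller c : Cwp ϖ) * aeval (m 1) (φ.eigenProjector hO).poly := by
  rcases eq_or_ne c 0 with rfl | hc
  · rw [hm0, GaEnd.aeval_zero, map_zero, Subring.coe_zero, zero_mul]
  have key : ∀ c, aeval (m c) (φ.eigenProjector hO).poly = -∑ b : (ResidueRing ϖ)ˣ,
      (hO.teichmuller ↑b⁻¹ : Cwp ϖ) * m (b * c) := fun c => by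
    rw [eigenProjector, GaEnd.poly_neg, GaEnd.poly_sum, map_neg, map_sum]
    congr 1
    refine Finset.sum_congr rfl fun b _ => ?_
    rw [GaEnd.poly_scalar_mul, map_mul, aeval_C, hm]
    congr 3
    exact Ideal.Quotient.mk_out _
  obtain ⟨v, rfl⟩ : ∃ v : (ResidueRing ϖ)ˣ, (v : ResidueRing ϖ) = c := ⟨Units.mk0 c hc, rfl⟩
  rw [key, key, mul_neg, Finset.mul_sum, ← Equiv.sum_comp (Equiv.mulRight v)
    (fun b : (ResidueRing ϖ)ˣ => (hO.teichmuller ↑v : Cwp ϖ) *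
      ((hO.teichmuller ↑b⁻¹ : Cwp ϖ) * m (b * 1)))]
  congr 1
  refine Finset.sum_congr rfl fun b _ => ?_
  rw [Equiv.coe_mulRight, mul_one, ← mul_assoc, ← Subring.coe_mul, ← map_mul, Units.val_mul,
    ← Units.val_mul v, mul_inv_rev, mul_inv_cancel_left]

end DrinfeldModule

end Eigen

/-! ### The geometric points of the canonical submodule -/

section Parametrization

variable {Fq : Type u} [Field Fq] [Finite Fq] {ϖ : Fq[X]} [Fact (Irreducible ϖ)]
  {O : Subring (Cwp ϖ)}

theorem coe_coeff_eq (f : O[X]) (i : ℕ) :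
    (f.coeff i : Cwp ϖ) = (f.map (algebraMap O (Cwp ϖ))).coeff i :=
  (coeff_map (algebraMap O (Cwp ϖ)) i).symm

theorem one_le_norm_coeff_zero_prod_X_sub_C {K : Type*} [NormedField K] (t : Multiset K)
    (ht : ∀ x ∈ t, 1 ≤ ‖x‖) : 1 ≤ ‖(t.map fun x => X - C x).prod.coeff 0‖ := by
  induction t using Multiset.induction_on with
  | empty => simp
  | cons x t ih =>
    rw [Multiset.map_cons, Multiset.prod_cons, mul_coeff_zero, norm_mul]
    refine one_le_mul_of_one_le_of_one_le ?_ (ih fun y hy => ht y (Multiset.mem_cons_of_mem hy))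
    simpa using ht x (Multiset.mem_cons_self _ _)

namespace DrinfeldModule

variable {r : ℕ} (φ : DrinfeldModule O r)

theorem map_torsion_coeff_one :
    ((φ.toRingHom ϖ).poly.map (algebraMap O (Cwp ϖ))).coeff 1 = polyToCwp ϖ ϖ := by
  rw [← coe_coeff_eq, φ.coeff_one]

theorem map_torsion_coeff_one_ne_zero :
    ((φ.toRingHom ϖ).poly.map (algebraMap O (Cwp ϖ))).coeff 1 ≠ 0 := by
  rw [map_torsion_coeff_one]
  exact polyToCwp_ne_zero ϖ (Fact.out : Irreducible ϖ).ne_zero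

theorem map_torsion_ne_zero : (φ.toRingHom ϖ).poly.map (algebraMap O (Cwp ϖ)) ≠ 0 :=
  fun h => φ.map_torsion_coeff_one_ne_zero (by rw [h, Polynomial.coeff_zero])

theorem nodup_roots_torsion :
    ((φ.toRingHom ϖ).poly.map (algebraMap O (Cwp ϖ))).roots.Nodup :=
  (φ.toRingHom ϖ).nodup_roots (by
    rw [← coeff_map]
    exact φ.map_torsion_coeff_one_ne_zero)

/-- Some nonzero `ϖ`-torsion point has absolute value less than one. -/
theorem exists_torsion_norm_lt_one (hO : IsBaseRing O) :
    ∃ x : Cwp ϖ, x ≠ 0 ∧ aeval x (φ.toRingHom ϖ).poly = 0 ∧ ‖x‖ < 1 := by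
  have := Cwp.isAlgClosed ϖ
  by_contra! hcon
  set p := (φ.toRingHom ϖ).poly.map (algebraMap O (Cwp ϖ)) with hp
  have hp0 : p ≠ 0 := φ.map_torsion_ne_zero
  have hmem : ∀ x, x ∈ p.roots ↔ aeval x (φ.toRingHom ϖ).poly = 0 := fun x => by
    rw [mem_roots hp0, IsRoot, hp, eval_map_algebraMap]
  obtain ⟨t, ht⟩ := Multiset.exists_cons_of_mem ((hmem 0).2 (GaEnd.aeval_zero _))
  have hnd := φ.nodup_roots_torsion
  rw [← hp, ht, Multiset.nodup_cons] at hnd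
  have h := (IsAlgClosed.splits p).eq_prod_roots
  -- After the simple root 0 is split off, ϖ is the leading coefficient, a unit, times the constant
  -- term of the remaining product. If all nonzero roots had norm ≥ 1, this would give |ϖ| ≥ 1.
  rw [ht, Multiset.map_cons, Multiset.prod_cons, C_0, sub_zero, mul_left_comm] at h
  have h1 := congrArg (fun f => f.coeff 1) h
  simp only [coeff_X_mul _ 0, coeff_C_mul] at h1
  rw [hp, map_torsion_coeff_one] at h1
  have h2 := one_le_norm_coeff_zero_prod_X_sub_C t fun x hx => by
    refine hcon x ?_ ((hmem x).1 (ht ▸ Multiset.mem_cons_of_mem hx))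
    rintro rfl
    exact hnd.1 hx
  have h3 : ‖p.leadingCoeff‖ = 1 := by
    rw [hp, leadingCoeff_map_of_injective Subtype.val_injective]
    exact hO.norm_eq_one (φ.isUnit_leadingCoeff ϖ (Fact.out : Irreducible ϖ).ne_zero)
  have h4 := (norm_polyToCwp_lt_one_iff ϖ ϖ).2 dvd_rfl
  rw [h1, ← hp, norm_mul, h3, one_mul] at h4
  exact h4.not_ge h2

/-- The geometric points of a canonical submodule scheme, parametrized by `A / ℘`. -/
theorem IsCanonicalSubmoduleScheme.exists_parametrization {φ : DrinfeldModule O r}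
    {H : φ.moduleScheme.ClosedSubmodule} (hH : φ.IsCanonicalSubmoduleScheme H)
    (hO : IsBaseRing O) :
    ∃ (δ : ℝ) (m : ResidueRing ϖ → Cwp ϖ), 0 ≤ δ ∧ δ < 1 ∧ m 0 = 0 ∧ Function.Injective m ∧
      (∀ a c, aeval (m c) (φ.toRingHom a).poly = m (Ideal.Quotient.mk _ a * c)) ∧
      (∀ c, ‖m c‖ ≤ δ) ∧ (∀ x, (∀ f ∈ H.gaIdeal, aeval x f = 0) ↔ ∃ c, m c = x) ∧
      ∀ x, aeval x (φ.toRingHom ϖ).poly = 0 → ‖x‖ ≤ δ → ∃ c, m c = x := by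
  obtain ⟨δ, ⟨⟨x₀, hx₀, hx₀0, hx₀δ⟩, hδ⟩, hN, ⟨e⟩⟩ := hH.isCanonicalSubmodule
  have hpt : ∀ x : Cwp ϖ, ∃ y : φ.moduleScheme.Points (Cwp ϖ), ModuleScheme.coord y = x :=
    fun x => (ModuleScheme.gaPointsEquiv (O := O) (Cwp ϖ)).surjective x
  have hci : Function.Injective
      (ModuleScheme.coord : φ.moduleScheme.Points (Cwp ϖ) → Cwp ϖ) :=
    (ModuleScheme.gaPointsEquiv (O := O) (Cwp ϖ)).injective
  have hc0 : ModuleScheme.coord (0 : φ.moduleScheme.Points (Cwp ϖ)) = 0 :=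
    ModuleScheme.coord_zero φ.toRingHom
  have htors : ∀ y : φ.moduleScheme.Points (Cwp ϖ), y ∈ (φ.torsion ϖ).points (Cwp ϖ) ↔
      aeval (ModuleScheme.coord y) (φ.toRingHom ϖ).poly = 0 := fun y => Iff.rfl
  have hmemI : ∀ y : φ.moduleScheme.Points (Cwp ϖ), y ∈ H.points (Cwp ϖ) ↔
      ∀ f ∈ H.gaIdeal, aeval (ModuleScheme.coord y) f = 0 := fun y => by
    rw [H.mem_points]
    exact forall₂_congr fun f _ => by
      rw [← ModuleScheme.apply_eq_aeval_coord φ.toRingHom y f]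
      exact Iff.rfl
  have hsurj : ∀ y ∈ H.points (Cwp ϖ),
      ∃ c, ModuleScheme.coord (e.symm c : φ.moduleScheme.Points (Cwp ϖ)) = ModuleScheme.coord y :=
    fun y hy => ⟨e ⟨y, hy⟩, by rw [e.symm_apply_apply]⟩
  refine ⟨δ, fun c => ModuleScheme.coord (e.symm c : φ.moduleScheme.Points (Cwp ϖ)),
    hx₀δ ▸ norm_nonneg _, ?_, ?_, fun c c' h => ?_, fun a c => ?_, fun c => ?_, fun x => ?_,
    fun x hx hxδ => ?_⟩
  · obtain ⟨x, hx0, hx, hx1⟩ := φ.exists_torsion_norm_lt_one hO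
    obtain ⟨y, rfl⟩ := hpt x
    refine (hδ ⟨y, (htors y).2 hx, ?_, rfl⟩).trans_lt hx1
    rintro rfl
    exact hx0 hc0
  · simpa using hc0
  · exact e.symm.injective (Subtype.ext (hci h))
  · have h : Ideal.Quotient.mk (Ideal.span {ϖ} : Ideal Fq[X]) a * c = a • c :=
      (Algebra.smul_def a c).symm
    simp only [h, map_smul, Submodule.coe_smul]
    exact (ModuleScheme.coord_smul φ.toRingHom a _).symm
  · exact ((hN _).1 (e.symm c).2).2
  · obtain ⟨y, rfl⟩ := hpt x
    rw [← hmemI]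
    refine ⟨hsurj y, ?_⟩
    rintro ⟨c, hc⟩
    rw [← hci hc]
    exact (e.symm c).2
  · obtain ⟨y, rfl⟩ := hpt x
    exact hsurj y ((hN y).2 ⟨hx, hxδ⟩)

end DrinfeldModule

end Parametrization

/-! ### Comparison of `ϖ / H_d` with the canonical points, and the choice of the scalar -/

section Normalization

variable {Fq : Type u} [Field Fq] [Finite Fq] {ϖ : Fq[X]} [Fact (Irreducible ϖ)]
  {O : Subring (Cwp ϖ)}

/-- Additivity of x ↦ x^Q gives (-1)^Q = -1 in every characteristic, without a case split on the
parity of q. -/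
theorem neg_one_pow_card_sub_one :
    (-1 : Cwp ϖ) ^ (Nat.card Fq ^ ϖ.natDegree - 1) = 1 := by
  have hQ := one_lt_card_pow ϖ
  have h := Cwp.sub_pow_card ϖ ϖ.natDegree 0 1
  rw [zero_sub, one_pow, zero_pow (by omega), zero_sub] at h
  have h2 := pow_succ (-1 : Cwp ϖ) (Nat.card Fq ^ ϖ.natDegree - 1)
  rw [Nat.sub_add_cancel hQ.le, h] at h2
  rw [mul_neg_one, neg_inj] at h2
  exact h2.symm

theorem prod_X_sub_C_coeff {k K : Type*} [Field k] [Fintype k] [Fintype kˣ] [Field K] {m : k → K}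
    (hm0 : m 0 = 0) : (∏ c, (X - C (m c))).coeff 0 = 0 ∧
      (∏ c, (X - C (m c))).coeff 1 = ∏ b : kˣ, -m b := by
  rw [prod_eq_mul_prod_units (fun c => X - C (m c)), hm0, C_0, sub_zero]
  refine ⟨by simp [mul_coeff_zero], ?_⟩
  rw [coeff_X_mul _ 0, coeff_zero_eq_eval_zero, eval_prod]
  simp

/-- The part of the Newton polygon of `φ_ϖ` relevant to the canonical submodule: the coefficient
`H_d` is nonzero and `ϖ / H_d` agrees with the product of the nonzero canonical points up to a
factor congruent to `1`. -/
theorem DrinfeldModule.coeffH_estimate {r : ℕ} (φ : DrinfeldModule O r) {δ : ℝ} (hδ : 0 ≤ δ)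
    {m : ResidueRing ϖ → Cwp ϖ} (hm0 : m 0 = 0) (hmδ : ∀ c, ‖m c‖ ≤ δ)
    (hdvd : ∏ c, (X - C (m c)) ∣ (φ.toRingHom ϖ).poly.map (algebraMap O (Cwp ϖ)))
    (hmem : ∀ x, aeval x (φ.toRingHom ϖ).poly = 0 → ‖x‖ ≤ δ → ∃ c, m c = x) :
    (φ.coeffH ϖ.natDegree : Cwp ϖ) ≠ 0 ∧ ∃ z : Cwp ϖ, ‖z - 1‖ < 1 ∧
      polyToCwp ϖ ϖ / φ.coeffH ϖ.natDegree = z * ∏ b : (ResidueRing ϖ)ˣ, -m b := by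
  have := Cwp.isAlgClosed ϖ
  obtain ⟨hP0, hP1⟩ := prod_X_sub_C_coeff hm0
  obtain ⟨R, hR⟩ := hdvd
  set p := (φ.toRingHom ϖ).poly.map (algebraMap O (Cwp ϖ)) with hp
  set P : (Cwp ϖ)[X] := ∏ c, (X - C (m c)) with hP
  have hp0 : p ≠ 0 := φ.map_torsion_ne_zero
  have hR0 : R ≠ 0 := by
    rintro rfl
    exact hp0 (by rw [hR, mul_zero])
  have hnd := φ.nodup_roots_torsion
  rw [← hp, hR, roots_mul (hR ▸ hp0)] at hnd
  have hPs : P = ((Finset.univ.val.map m).map fun x => X - C x).prod := by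
    rw [Multiset.map_map]
    rfl
  have ht : ∀ x ∈ R.roots, δ < ‖x‖ := by
    intro x hx
    by_contra! hle
    have hxp : aeval x (φ.toRingHom ϖ).poly = 0 := by
      rw [← eval_map_algebraMap, ← hp, hR, eval_mul, (mem_roots hR0).1 hx, mul_zero]
    obtain ⟨c, rfl⟩ := hmem x hxp hle
    -- The roots of φ_ϖ are simple, so a root of `R` cannot be one of the m_c, which are roots of
    -- `P`.
    refine Multiset.disjoint_left.1 (Multiset.nodup_add.1 hnd).2.2 ?_ hx
    rw [hPs, roots_multiset_prod_X_sub_C]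
    exact Multiset.mem_map_of_mem m (Finset.mem_univ_val c)
  have hRs := (IsAlgClosed.splits R).eq_prod_roots
  have key := norm_coeff_mul_sub_lt hδ (Finset.univ.val.map m) R.roots
    (fun x hx => by
      obtain ⟨c, -, rfl⟩ := Multiset.mem_map.1 hx
      exact hmδ c) ht (leadingCoeff_ne_zero.2 hR0)
  rw [← hRs, ← hPs, ← hR, Multiset.card_map, Finset.card_val, Finset.card_univ,
    ResidueRing.card_eq] at key
  have hH : p.coeff (Nat.card Fq ^ ϖ.natDegree) = (φ.coeffH ϖ.natDegree : Cwp ϖ) := by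
    rw [hp, ← coe_coeff_eq]
    rfl
  rw [hH] at key
  set h : Cwp ϖ := (φ.coeffH ϖ.natDegree : Cwp ϖ)
  have hRc : R.coeff 0 ≠ 0 := norm_pos_iff.1 ((norm_nonneg _).trans_lt key)
  have hh0 : h ≠ 0 := by
    intro h0
    rw [h0, zero_sub, norm_neg] at key
    exact key.false
  -- The 1-unit is R(0)/H_d: since P(0) = 0, the linear coefficient of P R gives ϖ = P_1 R(0).
  refine ⟨hh0, (h / R.coeff 0)⁻¹, norm_inv_sub_one_lt ?_, ?_⟩
  · rw [div_sub_one hRc, norm_div, div_lt_one (norm_pos_iff.2 hRc)]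
    exact key
  · have h1 := φ.map_torsion_coeff_one
    rw [← hp, hR, mul_coeff_one, hP0, hP1, zero_mul, zero_add] at h1
    rw [← h1, inv_div]
    ring

/-- Some scalar multiple of the eigenprojector maps the canonical points to the roots of
`X ^ (q ^ d) + (ϖ / H_d) X`. -/
theorem DrinfeldModule.exists_normalization {r : ℕ} (φ : DrinfeldModule O r) (hO : IsBaseRing O)
    {m : ResidueRing ϖ → Cwp ϖ} (hm0 : m 0 = 0) (hinj : Function.Injective m)
    (hm1 : ∀ c, ‖m c‖ < 1)
    (hm : ∀ a c, aeval (m c) (φ.toRingHom a).poly = m (Ideal.Quotient.mk _ a * c))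
    {P : O[X]} (hPm : P.Monic) (hP : P.map (algebraMap O (Cwp ϖ)) = ∏ c, (X - C (m c)))
    {t z : Cwp ϖ} (ht : t ∈ Subfield.closure (O : Set (Cwp ϖ))) (hz : ‖z - 1‖ < 1)
    (htz : t = z * ∏ b : (ResidueRing ϖ)ˣ, -m b) :
    t ∈ O ∧ ∃ w : O, IsUnit w ∧ ((w : Cwp ϖ) * aeval (m 1) (φ.eigenProjector hO).poly) ^
        (Nat.card Fq ^ ϖ.natDegree - 1) = -t ∧
      aeval (m 1) (φ.eigenProjector hO).poly ≠ 0 := by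
  classical
  have hQ := one_lt_card_pow ϖ
  set Q := Nat.card Fq ^ ϖ.natDegree with hQdef
  set f := (φ.eigenProjector hO).poly with hf
  have hf0 : f.coeff 0 = 0 := GaEnd.coeff_zero _
  have hf1 : ‖(f.coeff 1 : Cwp ϖ) - 1‖ < 1 := φ.norm_coeff_one_eigenProjector_sub_one_lt hO
  have hfm : ∀ c, aeval (m c) f = (hO.teichmuller c : Cwp ϖ) * aeval (m 1) f :=
    φ.aeval_eigenProjector hO hm0 hm
  have hmne : ∀ c, c ≠ 0 → m c ≠ 0 := fun c hc h => hc (hinj (h.trans hm0.symm))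
  have hratio : ∀ c, c ≠ 0 → ‖aeval (m c) f / m c - 1‖ < 1 := fun c hc =>
    hO.norm_aeval_div_sub_one_lt hf0 hf1 (hmne c hc) (hm1 c)
  set y := aeval (m 1) f with hy
  have hy0 : y ≠ 0 := by
    intro h
    have := hratio 1 one_ne_zero
    rw [← hy, h, zero_div, zero_sub, norm_neg, norm_one] at this
    exact this.false
  have hprod : ∏ b : (ResidueRing ϖ)ˣ, aeval (m b) f = -y ^ (Q - 1) := by
    -- Wilson's theorem in A/℘, transported by the Teichmüller lift; this is the source of the minus
    -- sign.
    have hw := FiniteField.prod_univ_units_id_eq_neg_one (K := ResidueRing ϖ)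
    have hw' := congrArg
      (fun u : (ResidueRing ϖ)ˣ => (hO.teichmuller (u : ResidueRing ϖ) : Cwp ϖ)) hw
    simp only [Units.coe_prod, map_prod, Units.val_neg, Units.val_one, map_neg, map_one,
      Subring.coe_neg, Subring.coe_one, SubmonoidClass.coe_finsetProd] at hw'
    rw [Finset.prod_congr rfl fun (b : (ResidueRing ϖ)ˣ) _ => hfm b,
      Finset.prod_mul_distrib, hw', Finset.prod_const, Finset.card_univ, ResidueRing.card_units, neg_one_mul]
  have hsign : ∏ b : (ResidueRing ϖ)ˣ, -m b = ∏ b : (ResidueRing ϖ)ˣ, m b := by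
    rw [Finset.prod_neg, Finset.card_univ, ResidueRing.card_units, neg_one_pow_card_sub_one,
      one_mul]
  have hprodne : ∏ b : (ResidueRing ϖ)ˣ, m b ≠ 0 :=
    Finset.prod_ne_zero_iff.2 fun b _ => hmne b b.ne_zero
  have hθ : t / (-y ^ (Q - 1)) = z * (∏ b : (ResidueRing ϖ)ˣ, aeval (m b) f / m b)⁻¹ := by
    rw [Finset.prod_div_distrib, hprod, htz, hsign, inv_div, mul_div_assoc]
  have hθ1 : ‖t / (-y ^ (Q - 1)) - 1‖ < 1 := by
    rw [hθ]
    exact norm_mul_sub_one_lt hz (norm_inv_sub_one_lt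
      (norm_prod_sub_one_lt _ _ fun b _ => hratio b b.ne_zero))
  -- The point m_1, and with it y, need not lie in Frac O. But f^Q - y^(Q-1) f vanishes at every
  -- m_c, so f^Q and y^(Q-1) f have the same remainder modulo P. The remainders of f^Q and f have
  -- coefficients in O, and that of f is nonzero, so y^(Q-1) is a quotient of two such coefficients.
  have hyfrac : y ^ (Q - 1) ∈ Subfield.closure (O : Set (Cwp ϖ)) := by
    have hdvd : P.map (algebraMap O (Cwp ϖ)) ∣ (f ^ Q).map (algebraMap O (Cwp ϖ)) -
        C (y ^ (Q - 1)) * f.map (algebraMap O (Cwp ϖ)) := by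
      rw [hP]
      refine Finset.prod_dvd_of_coprime (fun x _ x' _ hx => ?_) fun c _ => ?_
      · exact isCoprime_X_sub_C_of_isUnit_sub (sub_ne_zero.2 (hinj.ne hx)).isUnit
      · rw [dvd_iff_isRoot, IsRoot, eval_sub, eval_mul, eval_C, eval_map_algebraMap,
          eval_map_algebraMap, map_pow, hfm c, mul_pow]
        have h1 : (hO.teichmuller c : Cwp ϖ) ^ Q = hO.teichmuller c := by
          rw [← Subring.coe_pow, hO.teichmuller_pow]
        have h2 : y ^ Q = y ^ (Q - 1) * y := by rw [← pow_succ, Nat.sub_add_cancel hQ.le]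
        rw [h1, h2]
        ring
    rw [← modByMonic_eq_zero_iff_dvd (hPm.map _), sub_modByMonic, C_mul', smul_modByMonic,
      ← map_modByMonic _ hPm, ← map_modByMonic _ hPm, sub_eq_zero] at hdvd
    have hne : f %ₘ P ≠ 0 := by
      intro h0
      rw [modByMonic_eq_zero_iff_dvd hPm] at h0
      apply hy0
      obtain ⟨g, hg⟩ := h0
      have hP1 : aeval (m 1) P = 0 := by
        rw [← eval_map_algebraMap, hP, eval_prod]
        exact Finset.prod_eq_zero (Finset.mem_univ 1) (by simp)
      rw [hy, hg, map_mul, hP1, zero_mul]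
    obtain ⟨j, hj⟩ : ∃ j, (f %ₘ P).coeff j ≠ 0 := by
      by_contra! h
      exact hne (Polynomial.ext fun i => by rw [h i, Polynomial.coeff_zero])
    have hj' : ((f %ₘ P).coeff j : Cwp ϖ) ≠ 0 := fun h => hj (Subtype.ext h)
    have h1 := congrArg (fun g => g.coeff j) hdvd
    simp only [coeff_smul, smul_eq_mul, ← coe_coeff_eq] at h1
    rw [(eq_div_iff hj').2 h1.symm]
    exact _root_.div_mem (Subfield.subset_closure ((f ^ Q %ₘ P).coeff j).2)
      (Subfield.subset_closure ((f %ₘ P).coeff j).2)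
  have hyn : -y ^ (Q - 1) ≠ 0 := neg_ne_zero.2 (pow_ne_zero _ hy0)
  have htO : t ∈ O := by
    refine hO.mem_of_norm_lt_one ht ?_
    rw [htz, norm_mul, norm_eq_one_of_norm_sub_one_lt hz, one_mul, hsign,
      ← Finset.mul_prod_erase _ _ (Finset.mem_univ 1), norm_mul, norm_prod]
    exact mul_lt_one_of_nonneg_of_lt_one_left (norm_nonneg _) (hm1 _)
      (Finset.prod_le_one (fun _ _ => norm_nonneg _) fun b _ => (hm1 b).le)
  -- The root is extracted from t/(-y^(Q-1)), a 1-unit of Frac O and hence an element of O, so that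
  -- (w y)^(Q-1) = -t.
  obtain ⟨w, hwO, hw1, hw⟩ := hO.exists_pow_eq
    (hO.mem_of_norm_sub_one_lt (_root_.div_mem ht (neg_mem hyfrac)) hθ1) hθ1
  refine ⟨htO, ⟨w, hwO⟩, (hO.isUnit_iff _).2 (norm_eq_one_of_norm_sub_one_lt hw1).ge, ?_, hy0⟩
  rw [mul_pow, hw]
  field_simp

end Normalization

/-! ### The geometric points of `Z(c)` -/

section RootsOfZPoly

variable {Fq : Type u} [Field Fq] [Finite Fq] {ϖ : Fq[X]} [Fact (Irreducible ϖ)]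
  {O : Subring (Cwp ϖ)}

theorem IsBaseRing.teichmuller_injective (hO : IsBaseRing O) :
    Function.Injective (hO.teichmuller : ResidueRing ϖ → O) := by
  have := hO.isLocalRing
  exact hO.teichmuller.injective

/-- The multiples by Teichmüller representatives of one nonzero root are all the roots of
`X ^ (q ^ d) + c X`. -/
theorem mem_span_zPoly_iff (hO : IsBaseRing O) {c : O} {y : Cwp ϖ} (hy0 : y ≠ 0)
    (hy : y ^ (Nat.card Fq ^ ϖ.natDegree - 1) = -(c : Cwp ϖ)) (g : O[X]) :
    g ∈ Ideal.span {(zPoly hO c).poly} ↔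
      ∀ b : ResidueRing ϖ, aeval ((hO.teichmuller b : Cwp ϖ) * y) g = 0 := by
  have hQ := one_lt_card_pow ϖ
  set Q := Nat.card Fq ^ ϖ.natDegree with hQdef
  have hz : (zPoly hO c).poly = X ^ Q + C c * X := rfl
  have hdeg : (C c * X : O[X]).degree < Q := (degree_C_mul_X_le c).trans_lt (by exact_mod_cast hQ)
  have hmonic : (zPoly hO c).poly.Monic := hz ▸ monic_X_pow_add hdeg
  have hnat : (zPoly hO c).poly.natDegree = Q := by
    rw [hz, natDegree_add_eq_left_of_degree_lt (by rwa [degree_X_pow]), natDegree_X_pow]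
  have hroot : ∀ b : ResidueRing ϖ,
      aeval ((hO.teichmuller b : Cwp ϖ) * y) (zPoly hO c).poly = 0 := by
    intro b
    have h1 : (hO.teichmuller b : Cwp ϖ) ^ Q = hO.teichmuller b := by
      rw [← Subring.coe_pow, hO.teichmuller_pow]
    have h2 : y ^ Q = -(c : Cwp ϖ) * y := by rw [← hy, ← pow_succ, Nat.sub_add_cancel hQ.le]
    rw [hz, map_add, map_pow, map_mul, aeval_X, aeval_C, mul_pow, h1, h2]
    change _ + (c : Cwp ϖ) * _ = 0
    ring
  rw [Ideal.mem_span_singleton]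
  constructor
  · rintro ⟨h, rfl⟩ b
    rw [map_mul, hroot, zero_mul]
  · intro hg
    rw [← modByMonic_eq_zero_iff_dvd hmonic]
    apply map_injective (algebraMap O (Cwp ϖ)) Subtype.val_injective
    rw [Polynomial.map_zero]
    -- The remainder modulo the monic polynomial has degree < Q, yet it vanishes at the Q distinct
    -- points b̃ y.
    refine eq_zero_of_natDegree_lt_card_of_eval_eq_zero _
      (f := fun b : ResidueRing ϖ => (hO.teichmuller b : Cwp ϖ) * y) (fun b b' h => ?_)
      (fun b => ?_) ?_
    · exact hO.teichmuller_injective (Subtype.ext (mul_right_cancel₀ hy0 h))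
    · rw [eval_map_algebraMap, modByMonic_eq_sub_mul_div, map_sub, map_mul, hg, hroot,
        zero_mul, sub_zero]
    · rw [ResidueRing.card_eq, ← hQdef, ← hnat]
      exact natDegree_map_le.trans_lt (natDegree_modByMonic_lt _ hmonic (fun h => by
        rw [h, natDegree_one] at hnat
        omega))

end RootsOfZPoly

/-! ### The isomorphism with `Z(ϖ / H_d)` -/

theorem mainTheorem1 {Fq : Type u} [Field Fq] [Finite Fq] (ϖ : Fq[X]) [Fact (Irreducible ϖ)]
    (hϖ : ϖ.Monic) (O : Subring (Cwp ϖ)) (hO : IsBaseRing O) (r : ℕ) (hr : 2 ≤ r)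
    (φ : DrinfeldModule O r) (H : φ.moduleScheme.ClosedSubmodule)
    (hH : φ.IsCanonicalSubmoduleScheme H) :
    φ.coeffH ϖ.natDegree ≠ 0 ∧
      ∃ c : O, (c : Cwp ϖ) = polyToCwp ϖ ϖ / φ.coeffH ϖ.natDegree ∧
        Nonempty (ModuleScheme.Iso H.toModuleScheme (Z hO c).toModuleScheme) := by
  classical
  have := hO.isLocalRing
  obtain ⟨δ, m, hδ0, hδ1, hm0, hinj, hm, hmδ, hpts, hmem⟩ := hH.exists_parametrization hO
  have hϖI : (φ.toRingHom ϖ).poly ∈ H.gaIdeal :=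
    hH.le_torsion (Ideal.mem_span_singleton_self _)
  have hϖ0 : (φ.toRingHom ϖ).poly ≠ 0 := fun h =>
    φ.map_torsion_ne_zero (by rw [h, Polynomial.map_zero])
  obtain ⟨P, hPm, hP, hPI, hI⟩ := hO.exists_monic_span_eq H.gaIdeal hH.flat _ hϖI hϖ0
    φ.nodup_roots_torsion (Finset.univ.map ⟨m, hinj⟩) (fun x => by simp [hpts])
    (fun x hx => by
      obtain ⟨c, -, rfl⟩ := Finset.mem_map.1 hx
      exact (hmδ c).trans_lt hδ1)
  have hI' : ∀ f, f ∈ H.gaIdeal ↔ ∀ c, aeval (m c) f = 0 := fun f => by simp [hI]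
  rw [Finset.prod_map] at hP
  change _ = ∏ c, (X - C (m c)) at hP
  obtain ⟨hH0, z, hz, htz⟩ := φ.coeffH_estimate hδ0 hm0 hmδ
    (by
      rw [← hP]
      exact Polynomial.map_dvd _ (Ideal.mem_span_singleton.1 (hPI ▸ hϖI))) hmem
  have htfrac : polyToCwp ϖ ϖ / φ.coeffH ϖ.natDegree ∈ Subfield.closure (O : Set (Cwp ϖ)) := by
    rw [← φ.coeff_one]
    exact _root_.div_mem (Subfield.subset_closure (SetLike.coe_mem _))
      (Subfield.subset_closure (SetLike.coe_mem _))
  obtain ⟨htO, w, hw, hwy, hy0⟩ := φ.exists_normalization hO hm0 hinj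
    (fun c => (hmδ c).trans_lt hδ1) hm hPm hP htfrac hz htz
  refine ⟨fun h => hH0 (by rw [h, Subring.coe_zero]), ⟨_, htO⟩, rfl, ?_⟩
  set F : GaEnd O := GaEnd.scalar w * φ.eigenProjector hO with hF
  set y := (w : Cwp ϖ) * aeval (m 1) (φ.eigenProjector hO).poly with hy
  have hw0 : (w : Cwp ϖ) ≠ 0 := fun h => by
    have := hO.norm_eq_one hw
    rw [h, norm_zero] at this
    exact zero_ne_one this
  have hFm : ∀ c, aeval (m c) F.poly = (hO.teichmuller c : Cwp ϖ) * y := fun c => by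
    rw [hF, GaEnd.poly_scalar_mul, map_mul, aeval_C, φ.aeval_eigenProjector hO hm0 hm c, hy]
    change (w : Cwp ϖ) * _ = _
    ring
  refine ModuleScheme.nonempty_iso_gaKernel H (zPoly hO ⟨_, htO⟩) _ F (fun g => ?_) (fun g => ?_)
    fun a => ?_
  -- Both ideals are the vanishing ideals of their geometric points, and `F` matches m_c with the
  -- root c̃ y.
  · rw [hI', mem_span_zPoly_iff hO (mul_ne_zero hw0 hy0) hwy]
    exact forall_congr' fun c => by rw [aeval_comp, hFm]
  · refine exists_sub_comp_mem H.gaIdeal hPm (hPI ▸ Ideal.mem_span_singleton_self P)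
      (fun i hi => ?_) (GaEnd.coeff_zero F) ?_ g
    · have hdeg : P.natDegree = Fintype.card (ResidueRing ϖ) := by
        rw [← natDegree_map_eq_of_injective (f := algebraMap O (Cwp ϖ)) Subtype.val_injective P,
          hP]
        exact natDegree_finsetProd_X_sub_C_eq_card Finset.univ m
      rw [hO.mem_maximalIdeal_iff, coe_coeff_eq, hP]
      have hle := norm_coeff_prod_X_sub_C_le_pow hδ0 (Finset.univ.val.map m) (i := i)
        (j := P.natDegree - i) (fun x hx => by
          obtain ⟨c, -, rfl⟩ := Multiset.mem_map.1 hx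
          exact hmδ c) (by
          rw [Multiset.card_map, Finset.card_val, Finset.card_univ, ← hdeg]
          omega)
      rw [Multiset.map_map] at hle
      exact hle.trans_lt (pow_lt_one₀ hδ0 hδ1 (by omega))
    · rw [hF, GaEnd.poly_scalar_mul, coeff_C_mul]
      refine hw.mul ((hO.isUnit_iff _).2 ?_)
      exact (norm_eq_one_of_norm_sub_one_lt
        (φ.norm_coeff_one_eigenProjector_sub_one_lt hO)).ge
  -- Equivariance is likewise checked at the points: F(φ_a(m_c)) = F(m_{ac}) is the lift of a times
  -- F(m_c).
  · rw [hI']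
    intro c
    have h1 : (hO.scalarAction a * F).poly = C (hO.residueLift a) * F.poly :=
      GaEnd.poly_scalar_mul _ _
    rw [map_sub, GaEnd.poly_mul, aeval_comp, hm, hFm, h1, map_mul (aeval (m c)), aeval_C, hFm,
      map_mul hO.teichmuller, hO.teichmuller_mk, Subring.coe_mul]
    change _ - (hO.residueLift a : Cwp ϖ) * _ = 0
    ring
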